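/- Consider a single-item auction with $n$ buyers whose valuation profile $\mathbf v\in\mathbb R^n$ is drawn from a product distribution $\mathbf F=\mathbb F_1\times\cdots\times\mathbb F_n$. Let $v_{(k)}$ be the $k$-th largest of $v_1,\dots,v_n$. For a distribution $\mathbb G$ on $\mathbb R$ let $\Pi_k(\mathbb G)$ be the set of all product distributions $\mathbf F$ under which $v_{(k)}$ has distribution $\mathbb G$. A mechanism consists of measurable allocation probabilities $x_i(\mathbf v)\ge 0$ with $\sum_i x_i(\mathbf v)\le 1$ and measurable payments $t_i(\mathbf v)\in\mathbb R$, and $\mathrm{Rev}(\mathcal M,\mathbf F)=\mathbb E_{\mathbf v\sim\mathbf F}\big[\sum_i t_i(\mathbf v)\big]$, an extended real (taken as $-\infty$ if the expectations of the positive and negative parts are both infinite). Let $$R_k(\mathbb G)=\sup_{\mathcal M}\ \inf_{\mathbf F\in\Pi_k(\mathbb G)}\mathrm{Rev}(\mathcal M,\mathbf F),$$ where $\mathcal M$ ranges over the dominant-strategy incentive compatible and ex-post individually rational mechanisms. In the second-price auction $\mathsf{SPA}(p)$ with reserve $p$, the buyer with the highest value wins if her value is at least $p$ (ties are broken in favor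 of the smallest index) and pays $\max\{p,v_{(2)}\}$. Let $2\le k\le n$ and let $\mathbb G$ be a distribution on $\mathbb R$. There is a unique distribution $\overline{\mathbb F}=\overline{\mathbb F}_k(\mathbb G)$ on $\mathbb R$ with $\overline{\mathbb F}^n\in\Pi_k(\mathbb G)$, and the following hold. 1. For every reserve $p\ge 0$ (and, if $\mathbb G$ is supported on $[0,\infty)$, for every $p\in\mathbb R$), $$\min_{\mathbf F\in\Pi_k(\mathbb G)}\mathrm{Rev}(\mathsf{SPA}(p),\mathbf F)=\mathrm{Rev}\big(\mathsf{SPA}(p),\overline{\mathbb F}^n\big).$$ 2. Let $p^*\ge 0$ be a monopoly reserve of $\overline{\mathbb F}$, i.e. a maximizer of $x\cdot\Pr_{v\sim\overline{\mathbb F}}[v\ge x]$ over $x\in\mathbb R$, and suppose that $\overline{\mathbb F}$ is regular above $p^*$, in at least one of the following two senses: (a) $\overline{\mathbb F}$ has a density $f$ that is positive on $\{v\ge p^*:\overline{\mathbb F}(v)<1\}$ and for which the virtual value $v-\frac{1-\overline{\mathbb F}(v)}{f(v)}$ is non-decreasing on this set; or (b) (for an arbitrary $\overline{\mathbb F}$,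 possibly with atoms) the revenue curve $r(q)=q\cdot\sup\{x:\Pr_{v\sim\overline{\mathbb F}}[v\ge x]\ge q\}$, $r(0)=0$, is concave on $[0,\Pr_{v\sim\overline{\mathbb F}}[v\ge p^*]]$. Then $\mathsf{SPA}(p^*)$ is dominant-strategy incentive compatible and ex-post individually rational, and it is robustly optimal: $$\min_{\mathbf F\in\Pi_k(\mathbb G)}\mathrm{Rev}(\mathsf{SPA}(p^*),\mathbf F)=\mathrm{Rev}\big(\mathsf{SPA}(p^*),\overline{\mathbb F}^n\big)=R_k(\mathbb G).$$ -/

import Mathlib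

open MeasureTheory

noncomputable section

namespace OrderStatAuction

/-- The `k`-th order statistic `v_(k)` of a profile `v`, i.e. its `k`-th largest entry (`1 ≤ k ≤ n`):
the largest number `x` such that at least `k` entries are `≥ x`. -/
def orderStat {n : ℕ} (k : ℕ) (v : Fin n → ℝ) : ℝ :=
  sSup {x : ℝ | k ≤ (Finset.univ.filter fun i => x ≤ v i).card}

lemma le_orderStat_iff {n k : ℕ} (hk : 1 ≤ k) (hkn : k ≤ n) (v : Fin n → ℝ) (t : ℝ) :
    t ≤ orderStat k v ↔ k ≤ (Finset.univ.filter fun i => t ≤ v i).card := by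
  set S : Set ℝ := {x : ℝ | k ≤ (Finset.univ.filter fun i => x ≤ v i).card} with hS
  have hmem : ∀ x ∈ S, ∃ i, x ≤ v i := by
    intro x hx
    have : 0 < (Finset.univ.filter fun i => x ≤ v i).card := lt_of_lt_of_le hk hx
    obtain ⟨i, hi⟩ := Finset.card_pos.mp this
    exact ⟨i, (Finset.mem_filter.mp hi).2⟩
  have hn : (Finset.univ : Finset (Fin n)).Nonempty := by
    rw [← Finset.card_pos, Finset.card_univ, Fintype.card_fin]; omega
  have hbdd : BddAbove S := by
    refine ⟨Finset.univ.sup' hn v, fun x hx => ?_⟩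
    obtain ⟨i, hi⟩ := hmem x hx
    exact hi.trans (Finset.le_sup' v (Finset.mem_univ i))
  have hne : S.Nonempty := by
    refine ⟨Finset.univ.inf' hn v, ?_⟩
    have : (Finset.univ.filter fun i => Finset.univ.inf' hn v ≤ v i) = Finset.univ :=
      Finset.filter_true_of_mem fun i hi => Finset.inf'_le v hi
    change k ≤ _
    rw [this, Finset.card_univ, Fintype.card_fin]; exact hkn
  have hdown : ∀ x ∈ S, ∀ y ≤ x, y ∈ S := fun x hx y hy =>
    le_trans hx (Finset.card_le_card fun i hi => by
      simp only [Finset.mem_filter, Finset.mem_univ, true_and] at hi ⊢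
      exact hy.trans hi)
  constructor
  · intro ht
    by_contra hcon
    push Not at hcon
    -- the entries below `t` have a maximum, which bounds `S` strictly below `t`
    have hlt : ∀ x ∈ S, x < t := fun x hx => by
      by_contra h
      exact absurd (hdown x hx t (not_lt.mp h)) (not_le.mpr hcon)
    have hlow : (Finset.univ.filter fun i => v i < t).Nonempty := by
      rw [Finset.nonempty_iff_ne_empty]
      intro h
      have : (Finset.univ.filter fun i => t ≤ v i) = Finset.univ := by
        refine Finset.filter_true_of_mem fun i hi => ?_
        by_contra hi'
        have : i ∈ (Finset.univ.filter fun i => v i < t) := by simpa using hi'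
        rw [h] at this
        simp at this
      rw [this, Finset.card_univ, Fintype.card_fin] at hcon
      omega
    have hub : ∀ x ∈ S, x ≤ (Finset.univ.filter fun i => v i < t).sup' hlow v := by
      intro x hx
      by_contra h
      push Not at h
      refine absurd hx (not_le.mpr (lt_of_le_of_lt (Finset.card_le_card fun i hi => ?_) hcon))
      simp only [Finset.mem_filter, Finset.mem_univ, true_and] at hi ⊢
      by_contra hi'
      have := Finset.le_sup' v
        (show i ∈ (Finset.univ.filter fun i => v i < t) by simpa using hi')
      linarith
    have h1 : orderStat k v ≤ (Finset.univ.filter fun i => v i < t).sup' hlow v :=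
      csSup_le hne hub
    have h2 : (Finset.univ.filter fun i => v i < t).sup' hlow v < t := by
      rw [Finset.sup'_lt_iff]
      intro i hi
      exact (Finset.mem_filter.mp hi).2
    linarith
  · intro h
    exact le_csSup hbdd h

lemma measurable_orderStat {n : ℕ} (k : ℕ) :
    Measurable (orderStat k : (Fin n → ℝ) → ℝ) := by
  rcases Nat.eq_zero_or_pos k with rfl | hk
  · have : (orderStat 0 : (Fin n → ℝ) → ℝ) = fun _ => sSup Set.univ := by
      funext v; simp [orderStat]
    rw [this]; exact measurable_const
  by_cases hkn : k ≤ n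
  · refine measurable_of_Ici fun t => ?_
    have : (orderStat k : (Fin n → ℝ) → ℝ) ⁻¹' Set.Ici t =
        {v | k ≤ ∑ i : Fin n, (if t ≤ v i then 1 else 0)} := by
      ext v
      simp only [Set.mem_preimage, Set.mem_Ici, Set.mem_ofPred_eq]
      rw [le_orderStat_iff hk hkn, Finset.card_filter]
    rw [this]
    have hm : Measurable fun v : Fin n → ℝ => ∑ i : Fin n, (if t ≤ v i then 1 else 0 : ℕ) :=
      Finset.measurable_sum _ fun i _ =>
        Measurable.ite (measurableSet_le measurable_const (measurable_pi_apply i))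
          measurable_const measurable_const
    exact hm measurableSet_Ici
  · have : (orderStat k : (Fin n → ℝ) → ℝ) = fun _ => sSup ∅ := by
      funext v
      unfold orderStat
      congr 1
      ext x
      simp only [Set.mem_ofPred_eq, Set.mem_empty_iff_false, iff_false, not_le]
      exact lt_of_le_of_lt (Finset.card_le_univ _) (by rw [Fintype.card_fin]; omega)
    rw [this]; exact measurable_const

/-- The product distribution `F₁ × ⋯ × Fₙ` of the valuation profile. -/
def profileLaw {n : ℕ} (F : Fin n → ProbabilityMeasure ℝ) : Measure (Fin n → ℝ) :=
  Measure.pi fun i => (F i : Measure ℝ)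

/-- The distribution of the `k`-th order statistic under `F₁ × ⋯ × Fₙ`. -/
def orderStatLaw {n : ℕ} (k : ℕ) (F : Fin n → ProbabilityMeasure ℝ) : Measure ℝ :=
  (profileLaw F).map (orderStat k)

/-- The ambiguity set `Π_k(G)`: all product distributions on `ℝⁿ` whose `k`-th order statistic has
distribution `G`. -/
def ambiguitySet (n k : ℕ) (G : ProbabilityMeasure ℝ) : Set (Fin n → ProbabilityMeasure ℝ) :=
  {F | orderStatLaw k F = (G : Measure ℝ)}

/-- The i.i.d. product distribution `Fⁿ`. -/
def iid (n : ℕ) (F : ProbabilityMeasure ℝ) : Fin n → ProbabilityMeasure ℝ := fun _ => F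

/-- A direct, possibly randomized, single-item mechanism: `alloc v i` is the probability that buyer
`i` gets the item and `pay v i` is her expected payment when the reported profile is `v`. -/
structure Mechanism (n : ℕ) where
  alloc : (Fin n → ℝ) → Fin n → ℝ
  pay : (Fin n → ℝ) → Fin n → ℝ
  measurable_alloc : ∀ i, Measurable fun v => alloc v i
  measurable_pay : ∀ i, Measurable fun v => pay v i
  alloc_nonneg : ∀ v i, 0 ≤ alloc v i
  sum_alloc_le_one : ∀ v, ∑ i, alloc v i ≤ 1

namespace Mechanism

variable {n : ℕ}

/-- The utility of buyer `i` with value `x` when the reported profile is `b`. -/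
def utility (M : Mechanism n) (i : Fin n) (x : ℝ) (b : Fin n → ℝ) : ℝ :=
  x * M.alloc b i - M.pay b i

/-- Dominant-strategy incentive compatibility. -/
def IsDSIC (M : Mechanism n) : Prop :=
  ∀ (v : Fin n → ℝ) (i : Fin n) (b : ℝ),
    M.utility i (v i) (Function.update v i b) ≤ M.utility i (v i) v

/-- Ex-post individual rationality. -/
def IsIR (M : Mechanism n) : Prop :=
  ∀ (v : Fin n → ℝ) (i : Fin n), 0 ≤ M.utility i (v i) v

/-- The total payment collected at the profile `v`. -/
def totalPay (M : Mechanism n) (v : Fin n → ℝ) : ℝ := ∑ i, M.pay v i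

end Mechanism

/-- The expected revenue `Rev(M, F)`, as an extended real: expected positive part minus expected
negative part of the total payment (and `⊥` when both are infinite). -/
def Rev {n : ℕ} (M : Mechanism n) (F : Fin n → ProbabilityMeasure ℝ) : EReal :=
  ((∫⁻ v, ENNReal.ofReal (M.totalPay v) ∂(profileLaw F) : ENNReal) : EReal) -
    ((∫⁻ v, ENNReal.ofReal (-M.totalPay v) ∂(profileLaw F) : ENNReal) : EReal)

/-- The robust benchmark `R_k(G)`: the supremum of the worst-case revenue over `Π_k(G)`, over all
dominant-strategy incentive compatible, ex-post individually rational mechanisms. -/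
def robustRevenue (n k : ℕ) (G : ProbabilityMeasure ℝ) : EReal :=
  ⨆ (M : Mechanism n) (_ : M.IsDSIC ∧ M.IsIR), ⨅ F ∈ ambiguitySet n k G, Rev M F

/-- Profiles at which buyer `i` wins the second-price auction with reserve `p`: her value is at
least `p` and is the highest; ties are broken in favor of the smallest index. -/
def winSet {n : ℕ} (p : ℝ) (i : Fin n) : Set (Fin n → ℝ) :=
  {v | p ≤ v i ∧ (∀ j, v j ≤ v i) ∧ ∀ j, j < i → v j < v i}

lemma measurableSet_winSet {n : ℕ} (p : ℝ) (i : Fin n) : MeasurableSet (winSet p i) := by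
  refine (measurableSet_le measurable_const (measurable_pi_apply i)).inter
    (MeasurableSet.inter ?_ ?_)
  · have : {v : Fin n → ℝ | ∀ j, v j ≤ v i} = ⋂ j, {v | v j ≤ v i} := by ext; simp
    change MeasurableSet {v : Fin n → ℝ | ∀ j, v j ≤ v i}
    rw [this]
    exact MeasurableSet.iInter fun j =>
      measurableSet_le (measurable_pi_apply j) (measurable_pi_apply i)
  · have : {v : Fin n → ℝ | ∀ j, j < i → v j < v i} = ⋂ j, ⋂ (_ : j < i), {v | v j < v i} := by
      ext; simp
    change MeasurableSet {v : Fin n → ℝ | ∀ j, j < i → v j < v i}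
    rw [this]
    exact MeasurableSet.iInter fun j => MeasurableSet.iInter fun _ =>
      measurableSet_lt (measurable_pi_apply j) (measurable_pi_apply i)

lemma winSet_unique {n : ℕ} {p : ℝ} {i j : Fin n} {v : Fin n → ℝ}
    (hi : v ∈ winSet p i) (hj : v ∈ winSet p j) : i = j := by
  rcases lt_trichotomy i j with h | h | h
  · exact absurd (hi.2.1 j) (not_le.mpr (hj.2.2 i h))
  · exact h
  · exact absurd (hj.2.1 i) (not_le.mpr (hi.2.2 j h))

/-- The second-price auction with reserve price `p`: the highest buyer wins if her value is at least
`p`, and she pays the larger of `p` and the second-highest value. -/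
def SPA (n : ℕ) (p : ℝ) : Mechanism n where
  alloc v i := (winSet p i).indicator (fun _ => 1) v
  pay v i := (winSet p i).indicator (fun v => max p (orderStat 2 v)) v
  measurable_alloc i := measurable_const.indicator (measurableSet_winSet p i)
  measurable_pay i :=
    (measurable_const.max (measurable_orderStat 2)).indicator (measurableSet_winSet p i)
  alloc_nonneg v i := Set.indicator_nonneg (fun _ _ => zero_le_one) v
  sum_alloc_le_one v := by
    by_cases h : ∃ i, v ∈ winSet p i
    · obtain ⟨i, hi⟩ := h
      rw [Finset.sum_eq_single i]
      · simp [hi]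
      · intro j _ hj
        exact Set.indicator_of_notMem (fun hj' => hj (winSet_unique hj' hi)) _
      · simp
    · push Not at h
      rw [Finset.sum_eq_zero fun i _ => Set.indicator_of_notMem (h i) _]
      exact zero_le_one

/-- The probability `Pr[v ≥ x]` that a buyer with value distribution `F` accepts the price `x`. -/
def demand (F : ProbabilityMeasure ℝ) (x : ℝ) : ℝ := (F : Measure ℝ).real (Set.Ici x)

/-- `p` is a monopoly reserve price of `F`: a nonnegative maximizer of `x * Pr[v ≥ x]`. -/
def IsMonopolyReserve (F : ProbabilityMeasure ℝ) (p : ℝ) : Prop :=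
  0 ≤ p ∧ ∀ x : ℝ, x * demand F x ≤ p * demand F p

/-- The revenue curve `r(q) = q * F⁻¹(1 - q)`, where `F⁻¹(1 - q)` is the highest price that is
accepted with probability at least `q` (so that `r(0) = 0`). -/
def revenueCurve (F : ProbabilityMeasure ℝ) (q : ℝ) : ℝ :=
  q * sSup {x : ℝ | q ≤ demand F x}

/-- The virtual value `φ(v) = v - (1 - F(v)) / f(v)` of a distribution `F` with density `f`. -/
def virtualValue (F : ProbabilityMeasure ℝ) (f : ℝ → ℝ) (v : ℝ) : ℝ :=
  v - (F : Measure ℝ).real (Set.Ioi v) / f v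

/-- `F` has a density `f` whose virtual value is non-decreasing on `[p, ∞)`, within the range
`F(v) < 1`. (Positivity of `f` there says that the virtual value is never `-∞`.) -/
def VirtualValueMonotoneAbove (F : ProbabilityMeasure ℝ) (p : ℝ) : Prop :=
  ∃ f : ℝ → ℝ, Measurable f ∧ (∀ v, 0 ≤ f v) ∧
    (F : Measure ℝ) = volume.withDensity (fun v => ENNReal.ofReal (f v)) ∧
    (∀ v, p ≤ v → 0 < (F : Measure ℝ).real (Set.Ioi v) → 0 < f v) ∧
    MonotoneOn (virtualValue F f) {v | p ≤ v ∧ 0 < (F : Measure ℝ).real (Set.Ioi v)}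

/-- The revenue curve is concave on the quantiles of the values `≥ p`, i.e. on `[0, Pr[v ≥ p]]`. As
the virtual value is the slope of the revenue curve, this is the form that monotonicity of the
virtual value above `p` takes for arbitrary distributions, including those with atoms. For a
monopoly reserve `p` it says that the concave envelope of the revenue curve agrees with the revenue
curve on these quantiles. -/
def RevenueCurveConcaveAbove (F : ProbabilityMeasure ℝ) (p : ℝ) : Prop :=
  ConcaveOn ℝ (Set.Icc 0 (demand F p)) (revenueCurve F)

/-- `F` is regular above the reserve `p`: in terms of the virtual value if `F` has a density, or in
terms of the revenue curve for any `F`. -/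
def RegularAboveReserve (F : ProbabilityMeasure ℝ) (p : ℝ) : Prop :=
  VirtualValueMonotoneAbove F p ∨ RevenueCurveConcaveAbove F p

end OrderStatAuction

end

open OrderStatAuction

/-! The proof exhibits a saddle point: the i.i.d. distribution is the adversary's best reply to
every second-price auction with a nonnegative reserve, and the auction with the monopoly reserve is
the best reply to that distribution.

Worst case. Fix a threshold `t` and call buyer `i` a success if `t ≤ v i`. Order statistics see only
the number of successes of independent trials, so membership in the ambiguity set prescribes, for
each `t`, the probability of at least `k` successes (`mem_ambiguitySet_iff`). Under this constraint
equal success probabilities minimize the probabilities of at least one and at least two successes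
(`countMean_iid_le`). This is a smoothing argument: if `q i < x < q j`, replace `q i` by `x` and
adjust `q j` so that the constraint is kept. Then both `q i * q j` and `(1 - q i) * (1 - q j)` rise,
and Newton's inequality for the counts of the other trials gives the sign of the change. Hence the
two highest values are stochastically smallest in the i.i.d. case. For `p ≥ 0` the revenue is `p`
times the probability that the highest value reaches `p`, plus the expected excess of the
second-highest value over `p`, so it is smallest there as well.

Optimality. Against i.i.d. values the bound is Myerson's (`Rev_le_Rev_SPA`), carried out in quantile
space with extended nonnegative integrals, so that atoms and infinite means are allowed. The revenue
curve, continued as a constant beyond the monopoly quantile, has the form `ρ + ∫⁻ ψ` with `ψ ≥ 0`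
non-increasing. A buyer pays in expectation at most `ρ` plus her expected allocation weighted by
`ψ`, while the auction collects from her at least `ρ` plus the weight `ψ` on the event that her
quantile is lowest. Since `ψ` is non-increasing, giving the item to the lowest quantile maximizes
the weighted allocation pointwise. A monotone virtual value is reduced to concavity of the revenue
curve at the end. -/

namespace OrderStatAuction

/-! ### Numbers of successes in independent trials, and smoothing of the success probabilities. -/

section PoissonBinomial

variable {ι : Type*} [DecidableEq ι]

/-- The expectation of `φ` of the number of successes among independent trials `i ∈ s` with
success probabilities `q i`. -/
def countMean (s : Finset ι) (q : ι → ℝ) (φ : ℕ → ℝ) : ℝ :=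
  ∑ A ∈ s.powerset, φ A.card * ((∏ i ∈ A, q i) * ∏ i ∈ s \ A, (1 - q i))

/-- The indicator of at least `k` successes. -/
def atLeast (k l : ℕ) : ℝ := if k ≤ l then 1 else 0

/-- The indicator of exactly `k` successes. -/
def exactly (k l : ℕ) : ℝ := if l = k then 1 else 0

lemma countMean_empty (q : ι → ℝ) (φ : ℕ → ℝ) : countMean ∅ q φ = φ 0 := by
  simp [countMean]

/-- Conditioning on the outcome of trial `i`; all later recursions come from this one. -/
lemma countMean_insert {s : Finset ι} {i : ι} (hi : i ∉ s) (q : ι → ℝ) (φ : ℕ → ℝ) :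
    countMean (insert i s) q φ =
      (1 - q i) * countMean s q φ + q i * countMean s q (fun l => φ (l + 1)) := by
  unfold countMean
  rw [Finset.sum_powerset_insert hi, Finset.mul_sum, Finset.mul_sum]
  congr 1
  · refine Finset.sum_congr rfl fun A hA => ?_
    have hA' := Finset.mem_powerset.mp hA
    have hiA : i ∉ A := fun h => hi (hA' h)
    rw [Finset.insert_sdiff_of_notMem _ hiA, Finset.prod_insert (by simp [hi])]
    ring
  · refine Finset.sum_congr rfl fun A hA => ?_
    have hA' := Finset.mem_powerset.mp hA
    have hiA : i ∉ A := fun h => hi (hA' h)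
    have : insert i s \ insert i A = s \ A := by
      ext x; simp only [Finset.mem_sdiff, Finset.mem_insert]
      constructor
      · rintro ⟨h | h, h'⟩
        · exact absurd (Or.inl h) h'
        · exact ⟨h, fun hx => h' (Or.inr hx)⟩
      · rintro ⟨h, h'⟩
        exact ⟨Or.inr h, fun hx => hx.elim (fun e => hi (e ▸ h)) h'⟩
    rw [this, Finset.prod_insert hiA, Finset.card_insert_of_notMem hiA]
    ring

lemma countMean_congr {s : Finset ι} {q q' : ι → ℝ} (h : ∀ i ∈ s, q i = q' i) (φ : ℕ → ℝ) :
    countMean s q φ = countMean s q' φ := by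
  unfold countMean
  refine Finset.sum_congr rfl fun A hA => ?_
  have hA' := Finset.mem_powerset.mp hA
  have e1 : ∏ i ∈ A, q i = ∏ i ∈ A, q' i := Finset.prod_congr rfl fun i hi => h i (hA' hi)
  have e2 : ∏ i ∈ s \ A, (1 - q i) = ∏ i ∈ s \ A, (1 - q' i) :=
    Finset.prod_congr rfl fun i hi => by rw [h i (Finset.mem_sdiff.mp hi).1]
  rw [e1, e2]

lemma countMean_add (s : Finset ι) (q : ι → ℝ) (φ χ : ℕ → ℝ) :
    countMean s q (fun l => φ l + χ l) = countMean s q φ + countMean s q χ := by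
  unfold countMean
  rw [← Finset.sum_add_distrib]
  exact Finset.sum_congr rfl fun A _ => by ring

lemma countMean_mono_fun {s : Finset ι} {q : ι → ℝ} (h0 : ∀ i ∈ s, 0 ≤ q i)
    (h1 : ∀ i ∈ s, q i ≤ 1) {φ χ : ℕ → ℝ} (h : ∀ l, φ l ≤ χ l) :
    countMean s q φ ≤ countMean s q χ := by
  unfold countMean
  refine Finset.sum_le_sum fun A hA => mul_le_mul_of_nonneg_right (h _) ?_
  have hA' := Finset.mem_powerset.mp hA
  exact mul_nonneg (Finset.prod_nonneg fun i hi => h0 i (hA' hi))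
    (Finset.prod_nonneg fun i hi => sub_nonneg.mpr (h1 i (Finset.mem_sdiff.mp hi).1))

lemma countMean_zero (s : Finset ι) (q : ι → ℝ) : countMean s q (fun _ => 0) = 0 := by
  simp [countMean]

lemma countMean_nonneg {s : Finset ι} {q : ι → ℝ} (h0 : ∀ i ∈ s, 0 ≤ q i)
    (h1 : ∀ i ∈ s, q i ≤ 1) {φ : ℕ → ℝ} (h : ∀ l, 0 ≤ φ l) : 0 ≤ countMean s q φ := by
  rw [← countMean_zero s q]
  exact countMean_mono_fun h0 h1 h

lemma continuous_countMean (s : Finset ι) (φ : ℕ → ℝ) :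
    Continuous fun q : ι → ℝ => countMean s q φ := by
  unfold countMean
  fun_prop

lemma countMean_mono {s : Finset ι} {q q' : ι → ℝ} (h0 : ∀ i ∈ s, 0 ≤ q i)
    (h1 : ∀ i ∈ s, q' i ≤ 1) (hq : ∀ i ∈ s, q i ≤ q' i) {φ : ℕ → ℝ} (hφ : Monotone φ) :
    countMean s q φ ≤ countMean s q' φ := by
  induction s using Finset.induction_on generalizing φ with
  | empty => simp [countMean_empty]
  | insert i s hi ih =>
    rw [countMean_insert hi, countMean_insert hi]
    have m0 : ∀ j ∈ s, 0 ≤ q j := fun j hj => h0 j (Finset.mem_insert_of_mem hj)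
    have m1 : ∀ j ∈ s, q' j ≤ 1 := fun j hj => h1 j (Finset.mem_insert_of_mem hj)
    have mq : ∀ j ∈ s, q j ≤ q' j := fun j hj => hq j (Finset.mem_insert_of_mem hj)
    have a0 := h0 i (Finset.mem_insert_self _ _)
    have a1 := h1 i (Finset.mem_insert_self _ _)
    have aq := hq i (Finset.mem_insert_self _ _)
    have e1 := ih m0 m1 mq hφ
    have e2 := ih m0 m1 mq (φ := fun l => φ (l + 1)) fun a b h => hφ (Nat.succ_le_succ h)
    have e3 : countMean s q' φ ≤ countMean s q' fun l => φ (l + 1) :=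
      countMean_mono_fun (fun j hj => (m0 j hj).trans (mq j hj)) m1 fun l => hφ (Nat.le_succ l)
    have f1 : (1 - q i) * countMean s q φ ≤ (1 - q i) * countMean s q' φ :=
      mul_le_mul_of_nonneg_left e1 (by linarith)
    have f2 := mul_le_mul_of_nonneg_left e2 a0
    have f3 := mul_le_mul_of_nonneg_left e3 (sub_nonneg.mpr aq)
    nlinarith

lemma atLeast_monotone (k : ℕ) : Monotone (atLeast k) := by
  intro a b h
  unfold atLeast
  split_ifs <;> first | omega | norm_num

lemma atLeast_succ (k l : ℕ) : atLeast (k + 1) (l + 1) = atLeast (k + 1) l + exactly k l := by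
  unfold atLeast exactly
  split_ifs <;> first | omega | norm_num

lemma exactly_nonneg (k l : ℕ) : 0 ≤ exactly k l := by
  unfold exactly; split_ifs <;> norm_num

/-- Trial `i` is pivotal exactly when `k` of the other trials succeed. -/
lemma countMean_insert_atLeast {s : Finset ι} {i : ι} (hi : i ∉ s) (q : ι → ℝ) (k : ℕ) :
    countMean (insert i s) q (atLeast (k + 1)) =
      countMean s q (atLeast (k + 1)) + q i * countMean s q (exactly k) := by
  rw [countMean_insert hi]
  simp only [atLeast_succ]
  rw [countMean_add]; ring

lemma countMean_insert_exactly_zero {s : Finset ι} {i : ι} (hi : i ∉ s) (q : ι → ℝ) :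
    countMean (insert i s) q (exactly 0) = (1 - q i) * countMean s q (exactly 0) := by
  have : (fun l => exactly 0 (l + 1)) = fun _ => 0 := by funext l; simp [exactly]
  rw [countMean_insert hi, this, countMean_zero]; ring

lemma countMean_insert_exactly_succ {s : Finset ι} {i : ι} (hi : i ∉ s) (q : ι → ℝ) (k : ℕ) :
    countMean (insert i s) q (exactly (k + 1)) =
      (1 - q i) * countMean s q (exactly (k + 1)) + q i * countMean s q (exactly k) := by
  have : (fun l => exactly (k + 1) (l + 1)) = exactly k := by funext l; simp [exactly]
  rw [countMean_insert hi, this]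

lemma countMean_exactly_pos {s : Finset ι} {q : ι → ℝ} (h0 : ∀ i ∈ s, 0 < q i)
    (h1 : ∀ i ∈ s, q i < 1) {k : ℕ} (hk : k ≤ s.card) : 0 < countMean s q (exactly k) := by
  have hpos : ∀ A ∈ s.powerset, 0 < (∏ i ∈ A, q i) * ∏ i ∈ s \ A, (1 - q i) := fun A hA =>
    mul_pos (Finset.prod_pos fun i hi => h0 i (Finset.mem_powerset.mp hA hi))
      (Finset.prod_pos fun i hi => sub_pos.mpr (h1 i (Finset.mem_sdiff.mp hi).1))
  obtain ⟨A, hA, hc⟩ := Finset.exists_subset_card_eq hk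
  refine Finset.sum_pos' (fun B hB => mul_nonneg (exactly_nonneg _ _) (hpos B hB).le)
    ⟨A, Finset.mem_powerset.mpr hA, ?_⟩
  simpa [exactly, hc] using hpos A (Finset.mem_powerset.mpr hA)

/-- A weak form of Newton's inequality. -/
lemma exactly_zero_mul_le {s : Finset ι} {q : ι → ℝ} (h0 : ∀ i ∈ s, 0 ≤ q i)
    (h1 : ∀ i ∈ s, q i ≤ 1) (l : ℕ) :
    countMean s q (exactly 0) * countMean s q (exactly (l + 1)) ≤
      countMean s q (exactly 1) * countMean s q (exactly l) := by
  induction s using Finset.induction_on generalizing l with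
  | empty => simp [countMean_empty, exactly]
  | insert i s hi ih =>
    have m0 : ∀ j ∈ s, 0 ≤ q j := fun j hj => h0 j (Finset.mem_insert_of_mem hj)
    have m1 : ∀ j ∈ s, q j ≤ 1 := fun j hj => h1 j (Finset.mem_insert_of_mem hj)
    have a0 := h0 i (Finset.mem_insert_self _ _)
    have a1 := sub_nonneg.mpr (h1 i (Finset.mem_insert_self _ _))
    have p : ∀ l, 0 ≤ countMean s q (exactly l) := fun l =>
      countMean_nonneg m0 m1 (exactly_nonneg l)
    have e := mul_le_mul_of_nonneg_left (ih m0 m1 l) (mul_nonneg a1 a1)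
    -- For index `l + 1`, the difference of the two sides multiplies out to `(1 - q i) ^ 2` times
    -- the difference for `s`, plus the two products in `g1` and `g2`; the remaining cross terms
    -- cancel.
    have g1 := mul_nonneg (mul_nonneg a0 a0) (mul_nonneg (p 0) (p (l - 1)))
    have g2 := mul_nonneg (mul_nonneg a1 a0) (mul_nonneg (p 1) (p (l - 1)))
    rw [countMean_insert_exactly_zero hi, countMean_insert_exactly_succ hi,
      show exactly 1 = exactly (0 + 1) from rfl, countMean_insert_exactly_succ hi, zero_add]
    rcases l with _ | l
    · rw [countMean_insert_exactly_zero hi]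
      rw [zero_add] at e ⊢
      nlinarith
    · rw [countMean_insert_exactly_succ hi]
      rw [Nat.add_sub_cancel] at g1 g2
      nlinarith

/-- Bringing two success probabilities together (`a ≤ x ≤ b`, `a ≤ y ≤ b`) while keeping the weighted
sum `π₁ (x + y - x y) + π₀ x y` moves both `x y` and `(1 - x) (1 - y)` up. -/
lemma products_le_of_between {a b x y π₀ π₁ : ℝ} (ha : 0 < a) (hb : b < 1) (hax : a ≤ x)
    (hxb : x ≤ b) (h0 : 0 < π₀) (h1 : 0 ≤ π₁)
    (h : π₁ * (x + y - x * y) + π₀ * (x * y) = π₁ * (a + b - a * b) + π₀ * (a * b)) :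
    a * b ≤ x * y ∧ (1 - a) * (1 - b) ≤ (1 - x) * (1 - y) := by
  -- The comparison is with the partner `a + b - x` that keeps the sum. If `y` lies below it, the
  -- product of the failures rises; if above, the product of the successes does. The constraint,
  -- rewritten as `heq`, passes the sign from one product to the other.
  have key : a * b ≤ x * (a + b - x) := by nlinarith [mul_nonneg (sub_nonneg.2 hax) (sub_nonneg.2 hxb)]
  have key' : (1 - a) * (1 - b) ≤ (1 - x) * (1 - (a + b - x)) := by
    nlinarith [mul_nonneg (sub_nonneg.2 hax) (sub_nonneg.2 hxb)]
  have hx : 0 < x := ha.trans_le hax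
  have hx1 : 0 < 1 - x := by linarith
  have heq : π₀ * (x * y - a * b) = π₁ * ((1 - x) * (1 - y) - (1 - a) * (1 - b)) := by
    linear_combination h
  rcases le_total y (a + b - x) with hy | hy
  · have hB : (1 - a) * (1 - b) ≤ (1 - x) * (1 - y) :=
      key'.trans (mul_le_mul_of_nonneg_left (by linarith) hx1.le)
    refine ⟨?_, hB⟩
    have : 0 ≤ π₀ * (x * y - a * b) := heq ▸ mul_nonneg h1 (sub_nonneg.2 hB)
    exact sub_nonneg.1 (nonneg_of_mul_nonneg_right this h0)
  · have hA : a * b ≤ x * y := key.trans (mul_le_mul_of_nonneg_left hy hx.le)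
    refine ⟨hA, ?_⟩
    rcases h1.eq_or_lt with h1 | h1
    · rw [← h1, zero_mul] at heq
      have hxy : x * y = a * b := by
        rcases mul_eq_zero.1 heq with h' | h' <;> linarith
      have : y ≤ a + b - x := le_of_mul_le_mul_left (hxy ▸ key) hx
      exact key'.trans (mul_le_mul_of_nonneg_left (by linarith) hx1.le)
    · have : 0 ≤ π₁ * ((1 - x) * (1 - y) - (1 - a) * (1 - b)) :=
        heq ▸ mul_nonneg h0.le (sub_nonneg.2 hA)
      exact sub_nonneg.1 (nonneg_of_mul_nonneg_right this h1)

/-- Two trials enter only through the probability that at least one succeeds and the probability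
that both do, which makes the smoothing step a two-variable problem. -/
lemma countMean_pair_atLeast {s : Finset ι} {i j : ι} (hij : i ≠ j) (hi : i ∉ s) (hj : j ∉ s)
    (q : ι → ℝ) (k : ℕ) :
    countMean (insert i (insert j s)) q (atLeast (k + 2)) =
      countMean s q (atLeast (k + 2)) +
        (countMean s q (exactly (k + 1)) * (q i + q j - q i * q j) +
          countMean s q (exactly k) * (q i * q j)) := by
  rw [countMean_insert_atLeast (by simp [hij, hi]), countMean_insert_atLeast hj,
    countMean_insert_exactly_succ hj]
  ring

lemma countMean_pair_atLeast_one {s : Finset ι} {i j : ι} (hij : i ≠ j) (hi : i ∉ s) (hj : j ∉ s)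
    (q : ι → ℝ) :
    countMean (insert i (insert j s)) q (atLeast 1) =
      countMean s q (atLeast 1) + countMean s q (exactly 0) * (q i + q j - q i * q j) := by
  rw [show atLeast 1 = atLeast (0 + 1) from rfl, countMean_insert_atLeast (by simp [hij, hi]),
    countMean_insert_atLeast hj, countMean_insert_exactly_zero hj]
  ring

/-- Replacing the success probabilities `a = q i ≤ b = q j` by `x, y` between them such that the
probability of at least `k` successes is kept does not increase the probabilities of at least one
and of at least two successes. -/
lemma countMean_pair_le {s : Finset ι} {i j : ι} (hij : i ≠ j) (hi : i ∉ s) (hj : j ∉ s)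
    {q q' : ι → ℝ} (hs : ∀ l ∈ s, q' l = q l) (h0 : ∀ l ∈ s, 0 < q l) (h1 : ∀ l ∈ s, q l < 1)
    (hi0 : 0 < q i) (hj1 : q j < 1) (hx : q i ≤ q' i) (hx' : q' i ≤ q j)
    {k : ℕ} (hk : k ≤ s.card)
    (h : countMean (insert i (insert j s)) q' (atLeast (k + 2)) =
      countMean (insert i (insert j s)) q (atLeast (k + 2))) {r : ℕ} (hr : r = 1 ∨ r = 2) :
    countMean (insert i (insert j s)) q' (atLeast r) ≤
      countMean (insert i (insert j s)) q (atLeast r) := by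
  have g0 : ∀ l ∈ s, 0 ≤ q l := fun l hl => (h0 l hl).le
  have g1 : ∀ l ∈ s, q l ≤ 1 := fun l hl => (h1 l hl).le
  have p : ∀ l, 0 ≤ countMean s q (exactly l) := fun l => countMean_nonneg g0 g1 (exactly_nonneg l)
  have hpos := countMean_exactly_pos h0 h1 hk
  rw [countMean_pair_atLeast hij hi hj, countMean_pair_atLeast hij hi hj,
    countMean_congr hs, countMean_congr hs, countMean_congr hs] at h
  replace h := add_left_cancel h
  obtain ⟨hA, hB⟩ := products_le_of_between hi0 hj1 hx hx' hpos (p (k + 1)) h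
  rcases hr with rfl | rfl
  · rw [countMean_pair_atLeast_one hij hi hj, countMean_pair_atLeast_one hij hi hj,
      countMean_congr hs, countMean_congr hs]
    have := mul_le_mul_of_nonneg_left hB (p 0)
    linarith
  · rw [show atLeast 2 = atLeast (0 + 2) from rfl, countMean_pair_atLeast hij hi hj,
      countMean_pair_atLeast hij hi hj,
      countMean_congr hs, countMean_congr hs, countMean_congr hs, zero_add]
    have newton := exactly_zero_mul_le g0 g1 k
    have e := mul_le_mul_of_nonneg_right newton (sub_nonneg.2 hA)
    set A := q' i * q' j - q i * q j with hAdef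
    set B := (1 - q' i) * (1 - q' j) - (1 - q i) * (1 - q j) with hBdef
    have heq : countMean s q (exactly k) * A = countMean s q (exactly (k + 1)) * B := by
      rw [hAdef, hBdef]; linear_combination h
    -- With `π l` the probability of exactly `l` successes in `s`, the constraint reads `π k * A = π
    -- (k + 1) * B`, and the probability of at least two successes changes by `π 0 * A - π 1 * B`.
    -- Multiplying by `π (k + 1)` brings in Newton's inequality. The case `π (k + 1) = 0` occurs
    -- when `s` has only `k` elements, and then `A = 0`.
    have goal : countMean s q (exactly 0) * A ≤ countMean s q (exactly 1) * B := by
      have hB0 : 0 ≤ B := sub_nonneg.2 hB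
      rcases (p (k + 1)).eq_or_lt with hz | hz
      · rw [← hz, zero_mul] at heq
        have : A = 0 := (mul_eq_zero.1 heq).resolve_left hpos.ne'
        rw [this, mul_zero]; exact mul_nonneg (p 1) hB0
      · refine le_of_mul_le_mul_left ?_ hz
        calc _ = countMean s q (exactly 0) * countMean s q (exactly (k + 1)) * A := by ring
          _ ≤ countMean s q (exactly 1) * countMean s q (exactly k) * A := e
          _ = countMean s q (exactly 1) * (countMean s q (exactly k) * A) := by ring
          _ = _ := by rw [heq]; ring
    rw [hAdef, hBdef] at goal
    linarith

/-- Raising all trials but `i` to `x` is weakly favourable. The last raise is strict because trial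
`i` is then pivotal with positive probability, which needs `0 < x < 1`. -/
lemma countMean_lt_const {s : Finset ι} {q : ι → ℝ} {x : ℝ} (hx1 : x < 1)
    (h0 : ∀ i ∈ s, 0 ≤ q i) (hq : ∀ i ∈ s, q i ≤ x) {i : ι} (hi : i ∈ s) (hlt : q i < x)
    {k : ℕ} (hk : k < s.card) :
    countMean s q (atLeast (k + 1)) < countMean s (fun _ => x) (atLeast (k + 1)) := by
  have hx0 : 0 < x := (h0 i hi).trans_lt hlt
  have hni := Finset.notMem_erase i s
  calc countMean s q (atLeast (k + 1))
      ≤ countMean s (Function.update (fun _ => x) i (q i)) (atLeast (k + 1)) := by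
        refine countMean_mono h0 (fun j hj => ?_) (fun j hj => ?_) (atLeast_monotone _)
        · rcases eq_or_ne j i with rfl | h
          · simpa using (hq _ hi).trans hx1.le
          · simpa [h] using hx1.le
        · rcases eq_or_ne j i with rfl | h
          · simp
          · simpa [h] using hq j hj
    _ < _ := by
        rw [← Finset.insert_erase hi, countMean_insert_atLeast hni, countMean_insert_atLeast hni]
        have hc : ∀ j ∈ s.erase i, Function.update (fun _ => x) i (q i) j = x := fun j hj => by
          simp [Finset.ne_of_mem_erase hj]
        rw [countMean_congr hc, countMean_congr hc, Function.update_self]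
        have := countMean_exactly_pos (s := s.erase i) (q := fun _ => x) (fun _ _ => hx0)
          (fun _ _ => hx1) (k := k) (by rw [Finset.card_erase_of_mem hi]; omega)
        nlinarith

lemma countMean_const_strictMono {s : Finset ι} {k : ℕ} (hk : k < s.card) {x y : ℝ} (hx : 0 ≤ x)
    (hxy : x < y) (hy : y ≤ 1) :
    countMean s (fun _ => x) (atLeast (k + 1)) < countMean s (fun _ => y) (atLeast (k + 1)) := by
  obtain ⟨i, hi⟩ := Finset.card_pos.1 (Nat.zero_lt_of_lt hk)
  calc _ < countMean s (fun _ => (x + y) / 2) (atLeast (k + 1)) :=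
        countMean_lt_const (by linarith) (fun _ _ => hx) (fun _ _ => by linarith) hi
          (by linarith) hk
    _ ≤ _ := countMean_mono (fun _ _ => by linarith) (fun _ _ => hy) (fun _ _ => by linarith)
        (atLeast_monotone _)

/-- Induction on the number of trials with `q i ≠ x`. If all probabilities are at least `x`,
monotonicity suffices; they cannot all be at most `x` with one strictly below. Otherwise one lies
below and one above, and smoothing this pair sets one of them to `x`. Probabilities in the open
interval keep the point masses positive. -/
lemma countMean_iid_le_interior {s : Finset ι} {k : ℕ} (hk : k + 2 ≤ s.card) {x : ℝ} (hx0 : 0 < x)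
    (hx1 : x < 1) {r : ℕ} (hr : r = 1 ∨ r = 2) (q : ι → ℝ) (h0 : ∀ i ∈ s, 0 < q i)
    (h1 : ∀ i ∈ s, q i < 1)
    (h : countMean s (fun _ => x) (atLeast (k + 2)) ≤ countMean s q (atLeast (k + 2))) :
    countMean s (fun _ => x) (atLeast r) ≤ countMean s q (atLeast r) := by
  induction hN : (s.filter fun i => q i ≠ x).card using Nat.strong_induction_on generalizing q with
  | _ N ih =>
  by_cases hall : ∀ i ∈ s, x ≤ q i
  · exact countMean_mono (fun _ _ => hx0.le) (fun i hi => (h1 i hi).le) hall (atLeast_monotone _)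
  push Not at hall
  obtain ⟨i, hi, hix⟩ := hall
  by_cases hbig : ∀ j ∈ s, q j ≤ x
  · exact absurd h (not_le.2 (countMean_lt_const hx1 (fun j hj => (h0 j hj).le) hbig hi hix
      (by omega)))
  push Not at hbig
  obtain ⟨j, hj, hjx⟩ := hbig
  have hij : i ≠ j := by rintro rfl; linarith
  set t := (s.erase i).erase j with ht
  have hit : i ∉ t := by simp [ht]
  have hjt : j ∉ t := by simp [ht]
  have hji : j ∈ s.erase i := by simp [hij.symm, hj]
  have hst : s = insert i (insert j t) := by
    rw [ht, Finset.insert_erase hji, Finset.insert_erase hi]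
  have hts : ∀ l ∈ t, l ∈ s := fun l hl => by
    rw [hst]; exact Finset.mem_insert_of_mem (Finset.mem_insert_of_mem hl)
  have hcard : k ≤ t.card := by
    rw [hst, Finset.card_insert_of_notMem (by simp [hij, hit]),
      Finset.card_insert_of_notMem hjt] at hk
    omega
  let Q : ℝ → ι → ℝ := fun y => Function.update (Function.update q i x) j y
  have Qi : ∀ y, Q y i = x := fun y => by simp [Q, hij]
  have Qj : ∀ y, Q y j = y := fun y => by simp [Q]
  have Ql : ∀ y l, l ≠ i → l ≠ j → Q y l = q l := fun y l h1 h2 => by simp [Q, h1, h2]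
  have Qt : ∀ y, ∀ l ∈ t, Q y l = q l := fun y l hl =>
    Ql y l (by rintro rfl; exact hit hl) (by rintro rfl; exact hjt hl)
  have hcont : Continuous fun y => countMean s (Q y) (atLeast (k + 2)) :=
    (continuous_countMean s _).comp (by fun_prop)
  have hp : 0 ≤ countMean t q (exactly (k + 1)) :=
    countMean_nonneg (fun l hl => (h0 l (hts l hl)).le) (fun l hl => (h1 l (hts l hl)).le)
      (exactly_nonneg _)
  have hp' : 0 ≤ countMean t q (exactly k) :=
    countMean_nonneg (fun l hl => (h0 l (hts l hl)).le) (fun l hl => (h1 l (hts l hl)).le)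
      (exactly_nonneg _)
  have hform : ∀ y, countMean s (Q y) (atLeast (k + 2)) = countMean t q (atLeast (k + 2)) +
        (countMean t q (exactly (k + 1)) * (x + y - x * y) +
          countMean t q (exactly k) * (x * y)) := fun y => by
    rw [hst, countMean_pair_atLeast hij hit hjt, Qi, Qj, countMean_congr (Qt y),
      countMean_congr (Qt y), countMean_congr (Qt y)]
  have hformq : countMean s q (atLeast (k + 2)) = countMean t q (atLeast (k + 2)) +
        (countMean t q (exactly (k + 1)) * (q i + q j - q i * q j) +
          countMean t q (exactly k) * (q i * q j)) := by
    conv_lhs => rw [hst, countMean_pair_atLeast hij hit hjt]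
  have i0 := h0 i hi
  have j1 := h1 j hj
  have hlo : countMean s (Q (q i)) (atLeast (k + 2)) ≤ countMean s q (atLeast (k + 2)) := by
    rw [hform, hformq]
    have e1 : x + q i - x * q i ≤ q i + q j - q i * q j := by nlinarith
    have e2 : x * q i ≤ q i * q j := by nlinarith
    have := mul_le_mul_of_nonneg_left e1 hp
    have := mul_le_mul_of_nonneg_left e2 hp'
    linarith
  have hhi : countMean s q (atLeast (k + 2)) ≤ countMean s (Q (q j)) (atLeast (k + 2)) := by
    rw [hform, hformq]
    have e1 : q i + q j - q i * q j ≤ x + q j - x * q j := by nlinarith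
    have e2 : q i * q j ≤ x * q j := by nlinarith
    have := mul_le_mul_of_nonneg_left e1 hp
    have := mul_le_mul_of_nonneg_left e2 hp'
    linarith
  -- Pairing `x` with `q i` is worse than the original pair, pairing it with `q j` is better, so
  -- some `y` in between keeps the probability of at least `k + 2` successes.
  obtain ⟨y, hy, hyeq⟩ := intermediate_value_Icc (by linarith : q i ≤ q j) hcont.continuousOn
    ⟨hlo, hhi⟩
  simp only at hyeq
  have hstep : countMean s (Q y) (atLeast r) ≤ countMean s q (atLeast r) := by
    rw [hst] at hyeq ⊢
    exact countMean_pair_le hij hit hjt (Qt y) (fun l hl => h0 l (hts l hl))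
      (fun l hl => h1 l (hts l hl)) i0 j1 (by rw [Qi]; exact hix.le) (by rw [Qi]; exact hjx.le)
      hcard hyeq hr
  refine le_trans (ih _ ?_ (Q y) ?_ ?_ (hyeq ▸ h) rfl) hstep
  · rw [← hN]
    refine Finset.card_lt_card ⟨fun l hl => ?_, fun hsub => ?_⟩
    · rw [Finset.mem_filter] at hl ⊢
      refine ⟨hl.1, ?_⟩
      rcases eq_or_ne l i with rfl | hli
      · exact hix.ne
      rcases eq_or_ne l j with rfl | hlj
      · exact hjx.ne'
      · rw [← Ql y l hli hlj]; exact hl.2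
    · have := hsub (Finset.mem_filter.2 ⟨hi, hix.ne⟩)
      exact (Finset.mem_filter.1 this).2 (Qi y)
  all_goals
    intro l hl
    rcases eq_or_ne l i with rfl | hli
    · rw [Qi]; assumption
    rcases eq_or_ne l j with rfl | hlj
    · rw [Qj]; linarith [hy.1, hy.2]
  · rw [Ql y l hli hlj]; exact h0 l hl
  · rw [Ql y l hli hlj]; exact h1 l hl

/-- Among independent trials with a given probability of at least `k` successes, equal success
probabilities minimize the probabilities of at least one and of at least two successes. -/
lemma countMean_iid_le {s : Finset ι} {k : ℕ} (hk : k + 2 ≤ s.card) {x : ℝ} (hx0 : 0 ≤ x)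
    (hx1 : x ≤ 1) {r : ℕ} (hr : r = 1 ∨ r = 2) {q : ι → ℝ} (h0 : ∀ i, 0 ≤ q i)
    (h1 : ∀ i, q i ≤ 1)
    (h : countMean s (fun _ => x) (atLeast (k + 2)) ≤ countMean s q (atLeast (k + 2))) :
    countMean s (fun _ => x) (atLeast r) ≤ countMean s q (atLeast r) := by
  obtain ⟨r, rfl⟩ : ∃ r', r = r' + 1 := ⟨r - 1, by omega⟩
  by_contra! hcon
  have hx : 0 < x := by
    refine hx0.lt_of_ne fun hx => absurd hcon (not_lt.2 ?_)
    exact countMean_mono (fun _ _ => hx0) (fun i _ => h1 i) (fun i _ => hx ▸ h0 i)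
      (atLeast_monotone _)
  have hcx : Continuous fun y : ℝ => countMean s (fun _ => y) (atLeast (r + 1)) :=
    (continuous_countMean s _).comp (by fun_prop)
  -- Reduction to the interior case: lowering `x` slightly keeps the assumed violation and makes the
  -- constraint strict, which leaves room to move `q` off the boundary.
  obtain ⟨y, hy0, hyx, hyr⟩ : ∃ y, 0 < y ∧ y < x ∧
      countMean s q (atLeast (r + 1)) < countMean s (fun _ => y) (atLeast (r + 1)) := by
    have e1 : ∀ᶠ y in nhdsWithin x (Set.Iio x),
        countMean s q (atLeast (r + 1)) < countMean s (fun _ => y) (atLeast (r + 1)) :=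
      (hcx.tendsto x |>.mono_left nhdsWithin_le_nhds).eventually_const_lt hcon
    have e2 : ∀ᶠ y in nhdsWithin x (Set.Iio x), 0 < y :=
      Filter.Eventually.filter_mono nhdsWithin_le_nhds (lt_mem_nhds hx)
    obtain ⟨y, ⟨h1, h2⟩, h3⟩ := ((e1.and e2).and self_mem_nhdsWithin).exists
    exact ⟨y, h2, h3, h1⟩
  have hyk : countMean s (fun _ => y) (atLeast (k + 2)) < countMean s q (atLeast (k + 2)) :=
    (countMean_const_strictMono (by omega) hy0.le hyx hx1).trans_le h
  -- Mixing with the constant `1/2` puts every probability strictly between `0` and `1` for `0 < ε <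
  -- 1`.
  let Q : ℝ → ι → ℝ := fun ε i => (1 - ε) * q i + ε / 2
  have hQ : ∀ l, Continuous fun ε => countMean s (Q ε) (atLeast l) := fun l =>
    (continuous_countMean s _).comp (by fun_prop)
  have hQ0 : Q 0 = q := by funext i; simp [Q]
  have f1 : ∀ᶠ ε in nhdsWithin 0 (Set.Ioi 0),
      countMean s (fun _ => y) (atLeast (k + 2)) < countMean s (Q ε) (atLeast (k + 2)) := by
    refine ((hQ _).tendsto 0 |>.mono_left nhdsWithin_le_nhds).eventually_const_lt ?_
    simpa only [hQ0] using hyk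
  have f2 : ∀ᶠ ε in nhdsWithin 0 (Set.Ioi 0),
      countMean s (Q ε) (atLeast (r + 1)) < countMean s (fun _ => y) (atLeast (r + 1)) := by
    refine ((hQ _).tendsto 0 |>.mono_left nhdsWithin_le_nhds).eventually_lt_const ?_
    simpa only [hQ0] using hyr
  have f3 : ∀ᶠ ε : ℝ in nhdsWithin 0 (Set.Ioi 0), ε < 1 :=
    Filter.Eventually.filter_mono nhdsWithin_le_nhds (gt_mem_nhds one_pos)
  obtain ⟨ε, ⟨⟨g1, g2⟩, g3⟩, g4⟩ := (((f1.and f2).and f3).and self_mem_nhdsWithin).exists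
  have g4 : 0 < ε := g4
  refine absurd g2 (not_lt.2 (countMean_iid_le_interior hk hy0 (by linarith) hr (Q ε) ?_ ?_ g1.le))
  · intro i _
    have := mul_nonneg (sub_nonneg.2 g3.le) (h0 i)
    simp only [Q]; linarith
  · intro i _
    have := mul_nonneg (sub_nonneg.2 g3.le) (sub_nonneg.2 (h1 i))
    simp only [Q]; linarith

end PoissonBinomial

/-! ### Tails of order statistics, quantiles, and the i.i.d. member of the ambiguity set. -/

section OrderStatistics

variable {n : ℕ}

instance (F : Fin n → ProbabilityMeasure ℝ) : IsProbabilityMeasure (profileLaw F) := by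
  unfold profileLaw; infer_instance

lemma demand_nonneg (F : ProbabilityMeasure ℝ) (x : ℝ) : 0 ≤ demand F x := measureReal_nonneg

lemma demand_le_one (F : ProbabilityMeasure ℝ) (x : ℝ) : demand F x ≤ 1 := measureReal_le_one

/-- The event splits according to the set `A` of buyers with value at least `t`; each piece is a
box, whose measure is a product. -/
lemma profileLaw_real_count (F : Fin n → ProbabilityMeasure ℝ) (k : ℕ) (t : ℝ) :
    (profileLaw F).real {v | k ≤ (Finset.univ.filter fun i => t ≤ v i).card} =
      countMean Finset.univ (fun i => demand (F i) t) (atLeast k) := by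
  classical
  let E : Finset (Fin n) → Set (Fin n → ℝ) := fun A =>
    Set.univ.pi fun i => if i ∈ A then Set.Ici t else (Set.Ici t)ᶜ
  have hE : ∀ A v, v ∈ E A ↔ (Finset.univ.filter fun i => t ≤ v i) = A := by
    intro A v
    simp only [E, Set.mem_pi, Set.mem_univ, true_imp_iff, Finset.ext_iff, Finset.mem_filter,
      Finset.mem_univ, true_and]
    refine forall_congr' fun i => ?_
    by_cases h : i ∈ A <;> simp [h]
  have hEm : ∀ A, MeasurableSet (E A) := fun A => MeasurableSet.univ_pi fun i => by
    split_ifs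
    · exact measurableSet_Ici
    · exact measurableSet_Ici.compl
  have hEμ : ∀ A, (profileLaw F).real (E A) =
      (∏ i ∈ A, demand (F i) t) * ∏ i ∈ Finset.univ \ A, (1 - demand (F i) t) := by
    intro A
    rw [measureReal_def, profileLaw, Measure.pi_pi, ENNReal.toReal_prod,
      ← Finset.prod_sdiff (Finset.subset_univ A), mul_comm]
    congr 1
    · exact Finset.prod_congr rfl fun i hi => by simp [hi, demand, measureReal_def]
    · refine Finset.prod_congr rfl fun i hi => ?_
      rw [if_neg (Finset.mem_sdiff.1 hi).2, ← measureReal_def, probReal_compl_eq_one_sub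
        measurableSet_Ici, demand]
  have hset : {v : Fin n → ℝ | k ≤ (Finset.univ.filter fun i => t ≤ v i).card} =
      ⋃ A ∈ Finset.univ.powerset.filter (fun A : Finset (Fin n) => k ≤ A.card), E A := by
    ext v
    simp only [Set.mem_ofPred_eq, Set.mem_iUnion, hE, Finset.mem_filter, exists_prop]
    constructor
    · intro h
      exact ⟨_, ⟨Finset.mem_powerset.2 (Finset.subset_univ _), h⟩, rfl⟩
    · rintro ⟨A, ⟨_, h⟩, rfl⟩
      exact h
  rw [hset, measureReal_biUnion_finset _ fun A _ => hEm A]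
  · rw [countMean, Finset.sum_filter]
    refine Finset.sum_congr rfl fun A _ => ?_
    rw [hEμ, atLeast]
    split_ifs <;> ring
  · intro A _ B _ hAB
    refine Set.disjoint_left.2 fun v h1 h2 => hAB ?_
    rw [hE] at h1 h2
    exact h1.symm.trans h2

lemma profileLaw_real_le_orderStat (F : Fin n → ProbabilityMeasure ℝ) {k : ℕ} (hk : 1 ≤ k)
    (hkn : k ≤ n) (t : ℝ) :
    (profileLaw F).real {v | t ≤ orderStat k v} =
      countMean Finset.univ (fun i => demand (F i) t) (atLeast k) := by
  simp only [le_orderStat_iff hk hkn]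
  exact profileLaw_real_count F k t

/-- Upper tails determine a law on the line, so the constraint decouples into one condition per
threshold. -/
lemma mem_ambiguitySet_iff {k : ℕ} (hk : 1 ≤ k) (hkn : k ≤ n) (G : ProbabilityMeasure ℝ)
    (F : Fin n → ProbabilityMeasure ℝ) :
    F ∈ ambiguitySet n k G ↔
      ∀ t, countMean Finset.univ (fun i => demand (F i) t) (atLeast k) = demand G t := by
  have hm := measurable_orderStat (n := n) k
  have hprob : IsProbabilityMeasure (orderStatLaw k F) := by
    unfold orderStatLaw; exact Measure.isProbabilityMeasure_map hm.aemeasurable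
  have key : ∀ t, (orderStatLaw k F).real (Set.Ici t) =
      countMean Finset.univ (fun i => demand (F i) t) (atLeast k) := fun t => by
    rw [orderStatLaw, map_measureReal_apply hm measurableSet_Ici]
    exact profileLaw_real_le_orderStat F hk hkn t
  constructor
  · intro h t
    rw [← key, show orderStatLaw k F = G from h, demand]
  · intro h
    refine Measure.ext_of_Ici _ _ fun t => ?_
    rw [← measureReal_eq_measureReal_iff, key, h, demand]

lemma ext_of_demand {F F' : ProbabilityMeasure ℝ} (h : ∀ t, demand F t = demand F' t) :
    F = F' := by
  have key : (F : Measure ℝ) = (F' : Measure ℝ) :=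
    Measure.ext_of_Ici _ _ fun t => (measureReal_eq_measureReal_iff).1 (h t)
  exact Subtype.ext key

lemma demand_antitone (F : ProbabilityMeasure ℝ) : Antitone (demand F) := fun _ _ h =>
  measureReal_mono (Set.Ici_subset_Ici.2 h)

lemma tendsto_demand_atTop (F : ProbabilityMeasure ℝ) :
    Filter.Tendsto (demand F) Filter.atTop (nhds 0) := by
  have := tendsto_measure_iInter_atTop (μ := (F : Measure ℝ)) (s := fun x : ℝ => Set.Ici x)
    (fun x => measurableSet_Ici.nullMeasurableSet) (fun a b h => Set.Ici_subset_Ici.2 h)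
    ⟨0, measure_ne_top _ _⟩
  have he : ⋂ x : ℝ, Set.Ici x = ∅ := by
    refine Set.eq_empty_of_forall_notMem fun y hy => ?_
    have := Set.mem_iInter.1 hy (y + 1)
    simp only [Set.mem_Ici] at this; linarith
  rw [he, measure_empty] at this
  exact (ENNReal.tendsto_toReal ENNReal.zero_ne_top).comp this

lemma tendsto_demand_atBot (F : ProbabilityMeasure ℝ) :
    Filter.Tendsto (demand F) Filter.atBot (nhds 1) := by
  have := tendsto_measure_iUnion_atBot (μ := (F : Measure ℝ)) (s := fun x : ℝ => Set.Ici x)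
    (fun a b h => Set.Ici_subset_Ici.2 h)
  have he : ⋃ x : ℝ, Set.Ici x = Set.univ :=
    Set.eq_univ_of_forall fun y => Set.mem_iUnion.2 ⟨y, Set.self_mem_Ici⟩
  rw [he, measure_univ] at this
  exact (ENNReal.tendsto_toReal ENNReal.one_ne_top).comp this

/-- The demand is left-continuous. -/
lemma le_demand_of_forall_lt (F : ProbabilityMeasure ℝ) {q x : ℝ} (h : ∀ y < x, q ≤ demand F y) :
    q ≤ demand F x := by
  have hanti : Antitone fun m : ℕ => Set.Ici (x - 1 / ((m : ℝ) + 1)) := fun a b hab => by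
    refine Set.Ici_subset_Ici.2 ?_
    have := one_div_le_one_div_of_le (by positivity : (0 : ℝ) < a + 1)
      (by exact_mod_cast Nat.succ_le_succ hab : (a : ℝ) + 1 ≤ b + 1)
    linarith
  have := tendsto_measure_iInter_atTop (μ := (F : Measure ℝ))
    (fun m => measurableSet_Ici.nullMeasurableSet) hanti ⟨0, measure_ne_top _ _⟩
  have he : ⋂ m : ℕ, Set.Ici (x - 1 / ((m : ℝ) + 1)) = Set.Ici x := by
    ext y
    simp only [Set.mem_iInter, Set.mem_Ici]
    refine ⟨fun h => ?_, fun h m => ?_⟩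
    · have ht : Filter.Tendsto (fun m : ℕ => x - 1 / ((m : ℝ) + 1)) Filter.atTop (nhds (x - 0)) :=
        tendsto_const_nhds.sub tendsto_one_div_add_atTop_nhds_zero_nat
      rw [sub_zero] at ht
      exact le_of_tendsto' ht h
    · have : (0 : ℝ) < 1 / ((m : ℝ) + 1) := by positivity
      linarith
  rw [he] at this
  have ht := (ENNReal.tendsto_toReal (measure_ne_top (F : Measure ℝ) _)).comp this
  refine ge_of_tendsto' ht fun m => h _ ?_
  have : (0 : ℝ) < 1 / ((m : ℝ) + 1) := by positivity
  linarith

/-- The highest price accepted with probability at least `q`. -/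
noncomputable def quantilePrice (F : ProbabilityMeasure ℝ) (q : ℝ) : ℝ := sSup {x : ℝ | q ≤ demand F x}

lemma bddAbove_le_demand (F : ProbabilityMeasure ℝ) {q : ℝ} (hq : 0 < q) :
    BddAbove {x : ℝ | q ≤ demand F x} := by
  obtain ⟨b, hb⟩ := ((tendsto_demand_atTop F).eventually_lt_const hq).exists
  refine ⟨b, fun x hx => ?_⟩
  by_contra! hlt
  exact absurd (hx.trans (demand_antitone F hlt.le)) (not_le.2 hb)

lemma nonempty_le_demand (F : ProbabilityMeasure ℝ) {q : ℝ} (hq : q < 1) :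
    {x : ℝ | q ≤ demand F x}.Nonempty := by
  obtain ⟨b, hb⟩ := ((tendsto_demand_atBot F).eventually_const_lt hq).exists
  exact ⟨b, hb.le⟩

/-- Left-continuity of the demand makes the supremum attained. Nonemptiness is assumed instead of `q
< 1` because the monopoly quantile may equal `1`. -/
lemma le_quantilePrice_iff' (F : ProbabilityMeasure ℝ) {q x : ℝ} (hq : 0 < q)
    (hne : {x : ℝ | q ≤ demand F x}.Nonempty) :
    x ≤ quantilePrice F q ↔ q ≤ demand F x := by
  constructor
  · intro h
    refine le_demand_of_forall_lt F fun y hy => ?_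
    obtain ⟨z, hz, hyz⟩ := exists_lt_of_lt_csSup hne (hy.trans_le h)
    exact le_trans hz (demand_antitone F hyz.le)
  · exact fun h => le_csSup (bddAbove_le_demand F hq) h

lemma le_quantilePrice_iff (F : ProbabilityMeasure ℝ) {q x : ℝ} (hq : q ∈ Set.Ioo (0 : ℝ) 1) :
    x ≤ quantilePrice F q ↔ q ≤ demand F x :=
  le_quantilePrice_iff' F hq.1 (nonempty_le_demand F hq.2)

/-- The uniform distribution on the quantiles. -/
noncomputable def uniform : Measure ℝ := volume.restrict (Set.Ioo 0 1)

instance : IsProbabilityMeasure uniform := ⟨by simp [uniform]⟩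

lemma uniform_Iic {y : ℝ} (h1 : y ≤ 1) : uniform (Set.Iic y) = ENNReal.ofReal y := by
  rw [uniform, restrict_Ioo_eq_restrict_Ioc, Measure.restrict_apply measurableSet_Iic,
    Set.inter_comm, Set.Ioc_inter_Iic, min_eq_right h1, Real.volume_Ioc, sub_zero]

lemma ae_uniform_mem : ∀ᵐ u ∂uniform, u ∈ Set.Ioo (0 : ℝ) 1 :=
  ae_restrict_mem measurableSet_Ioo

lemma aemeasurable_of_antitoneOn_uniform {V : ℝ → ℝ} (h : AntitoneOn V (Set.Ioo 0 1)) :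
    AEMeasurable V uniform := aemeasurable_restrict_of_antitoneOn measurableSet_Ioo h

lemma quantilePrice_antitoneOn (F : ProbabilityMeasure ℝ) :
    AntitoneOn (quantilePrice F) (Set.Ioo 0 1) := fun _ ha _ hb hab =>
  (le_quantilePrice_iff F ha).2 (hab.trans ((le_quantilePrice_iff F hb).1 le_rfl))

lemma continuous_countMean_const (k : ℕ) :
    Continuous fun y : ℝ => countMean (Finset.univ : Finset (Fin n)) (fun _ => y) (atLeast k) :=
  (continuous_countMean _ _).comp (by fun_prop)

lemma countMean_const_zero (k : ℕ) :
    countMean (Finset.univ : Finset (Fin n)) (fun _ => 0) (atLeast (k + 1)) = 0 := by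
  unfold countMean
  refine Finset.sum_eq_zero fun A _ => ?_
  rcases Finset.eq_empty_or_nonempty A with rfl | ⟨i, hi⟩
  · simp [atLeast]
  · simp [Finset.prod_eq_zero hi]

lemma countMean_const_one {k : ℕ} (hkn : k ≤ n) :
    countMean (Finset.univ : Finset (Fin n)) (fun _ => 1) (atLeast k) = 1 := by
  unfold countMean
  rw [Finset.sum_eq_single Finset.univ]
  · simp [atLeast, hkn]
  · intro A _ hA
    have : (Finset.univ \ A).Nonempty := by
      rw [Finset.sdiff_nonempty]
      exact fun h => hA (Finset.univ_subset_iff.1 h)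
    simp [this.ne_empty]
  · simp

/-- The i.i.d. distribution with a given law of the `k`-th order statistic exists. -/
lemma exists_iid_mem_ambiguitySet {k : ℕ} (hkn : k + 1 ≤ n) (G : ProbabilityMeasure ℝ) :
    ∃ F : ProbabilityMeasure ℝ, iid n F ∈ ambiguitySet n (k + 1) G := by
  let h : ℝ → ℝ := fun y => countMean (Finset.univ : Finset (Fin n)) (fun _ => y) (atLeast (k + 1))
  have hcont : Continuous h := continuous_countMean_const _
  have h0 : h 0 = 0 := countMean_const_zero k
  have h1 : h 1 = 1 := countMean_const_one hkn
  have hlt : ∀ {x y}, 0 ≤ x → x < y → y ≤ 1 → h x < h y := fun hx hxy hy =>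
    countMean_const_strictMono (by simpa using hkn) hx hxy hy
  have hle : ∀ {x y}, 0 ≤ x → x ≤ y → y ≤ 1 → h x ≤ h y := fun hx hxy hy => by
    rcases hxy.eq_or_lt with rfl | hxy
    · exact le_rfl
    · exact (hlt hx hxy hy).le
  have hmem : ∀ u ∈ Set.Ioo (0 : ℝ) 1, h u ∈ Set.Ioo (0 : ℝ) 1 := fun u hu =>
    ⟨h0 ▸ hlt le_rfl hu.1 hu.2.le, h1 ▸ hlt hu.1.le hu.2 le_rfl⟩
  have hanti : AntitoneOn (fun u => quantilePrice G (h u)) (Set.Ioo 0 1) := fun a ha b hb hab =>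
    quantilePrice_antitoneOn G (hmem a ha) (hmem b hb) (hle ha.1.le hab hb.2.le)
  have hmeas := aemeasurable_of_antitoneOn_uniform hanti
  -- The demand has to be the inverse of `h` applied to the demand of `G`. Since `h` increases from
  -- `0` to `1`, feeding `h u` with `u` uniform into the quantile function of `G` achieves this.
  refine ⟨⟨uniform.map fun u => quantilePrice G (h u), Measure.isProbabilityMeasure_map hmeas⟩, ?_⟩
  rw [mem_ambiguitySet_iff (Nat.succ_pos k) hkn]
  intro t
  obtain ⟨y, hy, hyt⟩ := intermediate_value_Icc zero_le_one hcont.continuousOn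
    (show demand G t ∈ Set.Icc (h 0) (h 1) by
      rw [h0, h1]; exact ⟨demand_nonneg G t, demand_le_one G t⟩)
  have hd : (uniform.map fun u => quantilePrice G (h u)) (Set.Ici t) = ENNReal.ofReal y := by
    rw [Measure.map_apply_of_aemeasurable hmeas measurableSet_Ici, ← uniform_Iic hy.2]
    refine measure_congr ?_
    filter_upwards [ae_uniform_mem] with u hu
    refine propext ?_
    change t ≤ quantilePrice G (h u) ↔ u ≤ y
    rw [le_quantilePrice_iff G (hmem u hu), ← hyt]
    constructor
    · intro hh
      by_contra! hc
      exact absurd hh (not_le.2 (hlt hy.1 hc hu.2.le))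
    · exact fun hh => hle hu.1.le hh hy.2
  have : ∀ i, demand (iid n ⟨uniform.map fun u => quantilePrice G (h u),
      Measure.isProbabilityMeasure_map hmeas⟩ i) t = y := fun i => by
    rw [demand, measureReal_def]
    change ENNReal.toReal ((uniform.map fun u => quantilePrice G (h u)) (Set.Ici t)) = y
    rw [hd, ENNReal.toReal_ofReal hy.1]
  simp only [this]
  exact hyt

lemma iid_mem_ambiguitySet_unique {k : ℕ} (hkn : k + 1 ≤ n) {G F F' : ProbabilityMeasure ℝ}
    (hF : iid n F ∈ ambiguitySet n (k + 1) G) (hF' : iid n F' ∈ ambiguitySet n (k + 1) G) :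
    F = F' := by
  rw [mem_ambiguitySet_iff (Nat.succ_pos k) hkn] at hF hF'
  refine ext_of_demand fun t => ?_
  have h := (hF t).trans (hF' t).symm
  simp only [iid] at h
  rcases lt_trichotomy (demand F t) (demand F' t) with hlt | he | hlt
  · exact absurd h (countMean_const_strictMono (by simpa using hkn) (demand_nonneg F t) hlt
      (demand_le_one F' t)).ne
  · exact he
  · exact absurd h (countMean_const_strictMono (by simpa using hkn) (demand_nonneg F' t) hlt
      (demand_le_one F t)).ne'

/-- The two highest order statistics are stochastically smallest, within the ambiguity set, for the
i.i.d. distribution. -/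
lemma profileLaw_iid_le {k : ℕ} (hk : 2 ≤ k) (hkn : k ≤ n) {G F : ProbabilityMeasure ℝ}
    {H : Fin n → ProbabilityMeasure ℝ} (hF : iid n F ∈ ambiguitySet n k G)
    (hH : H ∈ ambiguitySet n k G) {r : ℕ} (hr : r = 1 ∨ r = 2) (t : ℝ) :
    profileLaw (iid n F) {v | t ≤ orderStat r v} ≤ profileLaw H {v | t ≤ orderStat r v} := by
  obtain ⟨k, rfl⟩ := Nat.exists_eq_add_of_le' hk
  rw [mem_ambiguitySet_iff (by omega) hkn] at hF hH
  rw [← ENNReal.toReal_le_toReal (measure_ne_top _ _) (measure_ne_top _ _), ← measureReal_def,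
    ← measureReal_def, profileLaw_real_le_orderStat _ (by omega) (by omega),
    profileLaw_real_le_orderStat _ (by omega) (by omega)]
  exact countMean_iid_le (by simpa using hkn) (demand_nonneg F t) (demand_le_one F t) hr
    (fun i => demand_nonneg _ t) (fun i => demand_le_one _ t) ((hF t).trans (hH t).symm).le

end OrderStatistics

/-! ### Revenue, worst case and incentives of the second-price auction. -/

section SecondPriceAuction

variable {n : ℕ}

lemma le_orderStat_one_iff (hn : 1 ≤ n) (v : Fin n → ℝ) (t : ℝ) :
    t ≤ orderStat 1 v ↔ ∃ i, t ≤ v i := by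
  rw [le_orderStat_iff le_rfl hn, Nat.one_le_iff_ne_zero, Finset.card_ne_zero]
  simp [Finset.filter_nonempty_iff]

lemma le_orderStat_two_of (hn : 2 ≤ n) {v : Fin n → ℝ} {t : ℝ} {i j : Fin n} (hij : i ≠ j)
    (hi : t ≤ v i) (hj : t ≤ v j) : t ≤ orderStat 2 v := by
  rw [le_orderStat_iff (by norm_num) hn]
  exact Finset.one_lt_card.2 ⟨i, by simpa using hi, j, by simpa using hj, hij⟩

lemma le_orderStat_two_iff (hn : 2 ≤ n) {v : Fin n → ℝ} {i : Fin n} (hi : ∀ j, v j ≤ v i) (t : ℝ) :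
    t ≤ orderStat 2 v ↔ ∃ j, j ≠ i ∧ t ≤ v j := by
  constructor
  · intro h
    rw [le_orderStat_iff (by norm_num) hn] at h
    obtain ⟨a, ha, b, hb, hab⟩ := Finset.one_lt_card.1 h
    simp only [Finset.mem_filter, Finset.mem_univ, true_and] at ha hb
    by_cases e : a = i
    · exact ⟨b, fun h' => hab (e.trans h'.symm), hb⟩
    · exact ⟨a, e, ha⟩
  · rintro ⟨j, hj, h⟩
    exact le_orderStat_two_of hn hj h (h.trans (hi j))

lemma orderStat_two_le_one (hn : 2 ≤ n) (v : Fin n → ℝ) : orderStat 2 v ≤ orderStat 1 v := by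
  rw [le_orderStat_iff le_rfl (by omega)]
  exact le_trans (by norm_num) ((le_orderStat_iff (by norm_num) hn v _).1 le_rfl)

lemma exists_mem_winSet (hn : 1 ≤ n) {p : ℝ} {v : Fin n → ℝ} (h : p ≤ orderStat 1 v) :
    ∃ i, v ∈ winSet p i := by
  obtain ⟨i₀, hi₀⟩ := (le_orderStat_one_iff hn v p).1 h
  obtain ⟨m, -, hm⟩ := Finset.exists_max_image Finset.univ v ⟨i₀, Finset.mem_univ _⟩
  set S := Finset.univ.filter fun i => v m ≤ v i with hS
  have hne : S.Nonempty := ⟨m, by simp [hS]⟩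
  have hmin := Finset.min'_mem S hne
  have hmin' : v m ≤ v (S.min' hne) := by simpa [hS] using hmin
  refine ⟨S.min' hne, (hi₀.trans (hm i₀ (Finset.mem_univ _))).trans hmin',
    fun j => (hm j (Finset.mem_univ _)).trans hmin', fun j hj => ?_⟩
  have : j ∉ S := fun hjS => absurd (S.min'_le j hjS) (not_le.2 hj)
  have : v j < v m := by simpa [hS] using this
  exact this.trans_le hmin'

lemma SPA_totalPay (hn : 1 ≤ n) (p : ℝ) (v : Fin n → ℝ) :
    (SPA n p).totalPay v = if p ≤ orderStat 1 v then max p (orderStat 2 v) else 0 := by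
  unfold Mechanism.totalPay
  change ∑ i, (winSet p i).indicator (fun v => max p (orderStat 2 v)) v = _
  split_ifs with h
  · obtain ⟨i, hi⟩ := exists_mem_winSet hn h
    rw [Finset.sum_eq_single i]
    · simp [hi]
    · intro j _ hj
      exact Set.indicator_of_notMem (fun hj' => hj (winSet_unique hj' hi)) _
    · simp
  · refine Finset.sum_eq_zero fun i _ => Set.indicator_of_notMem (fun hi => h ?_) _
    exact (le_orderStat_one_iff hn v p).2 ⟨i, hi.1⟩

lemma measurable_totalPay (M : Mechanism n) : Measurable M.totalPay :=
  Finset.measurable_sum _ fun i _ => M.measurable_pay i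

lemma SPA_totalPay_nonneg (hn : 1 ≤ n) {p : ℝ} (hp : 0 ≤ p) (v : Fin n → ℝ) :
    0 ≤ (SPA n p).totalPay v := by
  rw [SPA_totalPay hn]
  split_ifs
  · exact hp.trans (le_max_left _ _)
  · exact le_rfl

lemma Rev_SPA (hn : 1 ≤ n) {p : ℝ} (hp : 0 ≤ p) (F : Fin n → ProbabilityMeasure ℝ) :
    Rev (SPA n p) F =
      ((∫⁻ v, ENNReal.ofReal ((SPA n p).totalPay v) ∂profileLaw F : ENNReal) : EReal) := by
  have : ∀ v, ENNReal.ofReal (-(SPA n p).totalPay v) = 0 := fun v =>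
    ENNReal.ofReal_of_nonpos (neg_nonpos.2 (SPA_totalPay_nonneg hn hp v))
  simp [Rev, this]

/-- The payment is `p` if the highest value reaches `p`, plus the positive part of the
second-highest value minus `p`; the layer-cake formula applies to the latter. The result is monotone
in the upper tails. -/
lemma lintegral_SPA_totalPay (hn : 2 ≤ n) {p : ℝ} (hp : 0 ≤ p) (μ : Measure (Fin n → ℝ)) :
    ∫⁻ v, ENNReal.ofReal ((SPA n p).totalPay v) ∂μ =
      ENNReal.ofReal p * μ {v | p ≤ orderStat 1 v} +
        ∫⁻ t in Set.Ioi (0 : ℝ), μ {v | p + t ≤ orderStat 2 v} := by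
  have h1 : MeasurableSet {v : Fin n → ℝ | p ≤ orderStat 1 v} :=
    measurableSet_le measurable_const (measurable_orderStat 1)
  have key : ∀ v : Fin n → ℝ, ENNReal.ofReal ((SPA n p).totalPay v) =
      {v | p ≤ orderStat 1 v}.indicator (fun _ => ENNReal.ofReal p) v +
        ENNReal.ofReal (max (orderStat 2 v - p) 0) := by
    intro v
    rw [SPA_totalPay (by omega)]
    have h21 := orderStat_two_le_one hn v
    by_cases h : p ≤ orderStat 1 v
    · rw [if_pos h, Set.indicator_of_mem (show v ∈ {v | p ≤ orderStat 1 v} from h),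
        ← ENNReal.ofReal_add hp (le_max_right _ _)]
      congr 1
      rcases le_total p (orderStat 2 v) with h' | h'
      · rw [max_eq_right h', max_eq_left (by linarith)]; ring
      · rw [max_eq_left h', max_eq_right (by linarith)]; ring
    · rw [if_neg h, Set.indicator_of_notMem (show v ∉ {v | p ≤ orderStat 1 v} from h),
        max_eq_right (by linarith)]
      simp
  simp_rw [key]
  rw [lintegral_add_left (measurable_const.indicator h1), lintegral_indicator_const h1]
  congr 1
  rw [lintegral_eq_lintegral_meas_le μ (f := fun v => max (orderStat 2 v - p) 0)
    (Filter.Eventually.of_forall fun v => le_max_right _ _)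
    (((measurable_orderStat 2).sub_const p).max measurable_const).aemeasurable]
  refine setLIntegral_congr_fun measurableSet_Ioi fun t ht => ?_
  have ht : 0 < t := ht
  congr 1
  ext v
  simp only [Set.mem_ofPred_eq, le_max_iff]
  constructor
  · rintro (h | h) <;> linarith
  · intro h; left; linarith

lemma isLeast_Rev_SPA_of_nonneg {k : ℕ} (hk : 2 ≤ k) (hkn : k ≤ n) {G F : ProbabilityMeasure ℝ}
    (hF : iid n F ∈ ambiguitySet n k G) {p : ℝ} (hp : 0 ≤ p) :
    IsLeast (Rev (SPA n p) '' ambiguitySet n k G) (Rev (SPA n p) (iid n F)) := by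
  refine ⟨⟨_, hF, rfl⟩, ?_⟩
  rintro _ ⟨H, hH, rfl⟩
  rw [Rev_SPA (by omega) hp, Rev_SPA (by omega) hp, EReal.coe_ennreal_le_coe_ennreal_iff,
    lintegral_SPA_totalPay (by omega) hp, lintegral_SPA_totalPay (by omega) hp]
  refine add_le_add ?_ (lintegral_mono fun t => profileLaw_iid_le hk hkn hF hH (Or.inr rfl) _)
  exact mul_le_mul_right (profileLaw_iid_le hk hkn hF hH (Or.inl rfl) _) _

lemma Rev_congr_ae {M M' : Mechanism n} {F : Fin n → ProbabilityMeasure ℝ}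
    (h : ∀ᵐ v ∂profileLaw F, M.totalPay v = M'.totalPay v) : Rev M F = Rev M' F := by
  unfold Rev
  rw [lintegral_congr_ae (h.mono fun v hv => by simp only [hv] :
      (fun v => ENNReal.ofReal (M.totalPay v)) =ᵐ[profileLaw F] fun v => ENNReal.ofReal (M'.totalPay v)),
    lintegral_congr_ae (h.mono fun v hv => by simp only [hv] :
      (fun v => ENNReal.ofReal (-M.totalPay v)) =ᵐ[profileLaw F]
        fun v => ENNReal.ofReal (-M'.totalPay v))]

/-- If the `k`-th highest value is nonnegative, a negative reserve acts like the reserve `0`. -/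
lemma Rev_SPA_of_neg {k : ℕ} (hk : 2 ≤ k) (hkn : k ≤ n) {G : ProbabilityMeasure ℝ}
    (hG : (G : Measure ℝ) (Set.Iio 0) = 0) {H : Fin n → ProbabilityMeasure ℝ}
    (hH : H ∈ ambiguitySet n k G) {p : ℝ} (hp : p ≤ 0) :
    Rev (SPA n p) H = Rev (SPA n 0) H := by
  refine Rev_congr_ae ?_
  have h0 : ∀ᵐ v ∂profileLaw H, 0 ≤ orderStat k v := by
    rw [ae_iff]
    have hm := measurable_orderStat (n := n) k
    have : (profileLaw H).map (orderStat k) (Set.Iio 0) = 0 := by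
      rw [show (profileLaw H).map (orderStat k) = (G : Measure ℝ) from hH, hG]
    rw [Measure.map_apply hm measurableSet_Iio] at this
    simp only [not_le]
    exact this
  filter_upwards [h0] with v hv
  have h2 : 0 ≤ orderStat 2 v := by
    rw [le_orderStat_iff (by omega) hkn] at hv
    rw [le_orderStat_iff (by norm_num) (by omega)]
    exact hk.trans hv
  have h1 := h2.trans (orderStat_two_le_one (by omega) v)
  rw [SPA_totalPay (by omega), SPA_totalPay (by omega), if_pos h1, if_pos (hp.trans h1),
    max_eq_right h2, max_eq_right (hp.trans h2)]

/-- The i.i.d. distribution is the worst case of the second-price auction. -/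
lemma isLeast_Rev_SPA {k : ℕ} (hk : 2 ≤ k) (hkn : k ≤ n) {G F : ProbabilityMeasure ℝ}
    (hF : iid n F ∈ ambiguitySet n k G) {p : ℝ} (hp : 0 ≤ p ∨ (G : Measure ℝ) (Set.Iio 0) = 0) :
    IsLeast (Rev (SPA n p) '' ambiguitySet n k G) (Rev (SPA n p) (iid n F)) := by
  rcases le_total 0 p with h | h
  · exact isLeast_Rev_SPA_of_nonneg hk hkn hF h
  rcases hp with hp | hG
  · exact isLeast_Rev_SPA_of_nonneg hk hkn hF hp
  have := isLeast_Rev_SPA_of_nonneg hk hkn hF le_rfl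
  rwa [Set.image_congr fun H hH => Rev_SPA_of_neg hk hkn hG hH h, Rev_SPA_of_neg hk hkn hG hF h]

lemma SPA_utility (p : ℝ) (i : Fin n) (x : ℝ) (v : Fin n → ℝ) :
    (SPA n p).utility i x v =
      (winSet p i).indicator (fun v => x - max p (orderStat 2 v)) v := by
  unfold Mechanism.utility
  change x * (winSet p i).indicator (fun _ => 1) v -
    (winSet p i).indicator (fun v => max p (orderStat 2 v)) v = _
  by_cases h : v ∈ winSet p i <;> simp [h]

lemma SPA_isIR (hn : 2 ≤ n) (p : ℝ) : (SPA n p).IsIR := by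
  intro v i
  rw [SPA_utility]
  by_cases h : v ∈ winSet p i
  · rw [Set.indicator_of_mem h, sub_nonneg, max_le_iff]
    refine ⟨h.1, ?_⟩
    obtain ⟨j, -, hj⟩ := (le_orderStat_two_iff hn h.2.1 _).1 (le_refl (orderStat 2 v))
    exact hj.trans (h.2.1 j)
  · rw [Set.indicator_of_notMem h]

/-- A winner's price is the larger of the reserve and the highest competing bid, so it does not
depend on her report. -/
lemma SPA_isDSIC (hn : 2 ≤ n) (p : ℝ) : (SPA n p).IsDSIC := by
  intro v i b
  by_cases hw : Function.update v i b ∈ winSet p i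
  swap
  · rw [SPA_utility p i (v i) (Function.update v i b), Set.indicator_of_notMem hw]
    exact SPA_isIR hn p v i
  rw [SPA_utility, SPA_utility, Set.indicator_of_mem hw]
  have hwi := le_orderStat_two_iff hn hw.2.1
  by_cases hv : v ∈ winSet p i
  · rw [Set.indicator_of_mem hv]
    have : orderStat 2 (Function.update v i b) = orderStat 2 v := by
      refine eq_of_forall_le_iff fun t => ?_
      rw [hwi, le_orderStat_two_iff hn hv.2.1]
      refine exists_congr fun j => and_congr_right fun hj => ?_
      rw [Function.update_of_ne hj]
    rw [this]
  · rw [Set.indicator_of_notMem hv, sub_nonpos]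
    -- If a winning misreport were profitable, the true value would exceed the reserve and all other
    -- bids, so the truthful report would win too.
    by_contra! hcon
    obtain ⟨h1, h2⟩ := max_lt_iff.1 hcon
    have hlt : ∀ j, j ≠ i → v j < v i := fun j hj =>
      lt_of_le_of_lt ((hwi _).2 ⟨j, hj, by rw [Function.update_of_ne hj]⟩) h2
    refine hv ⟨h1.le, fun j => ?_, fun j hj => hlt j hj.ne⟩
    rcases eq_or_ne j i with rfl | hj
    · exact le_rfl
    · exact (hlt j hj).le

end SecondPriceAuction

/-! ### The ironed revenue curve and its non-increasing density. -/

section ConcaveRevenue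

open Set Filter Topology

/-- The density is the right derivative. The fundamental theorem of calculus applies on intervals
away from `0`, and then the left endpoint tends to `0`. The constant `ρ` is the limit of `g` at `0`,
which is positive for revenue curves with a jump there, as for tails of order `1 / x`. -/
lemma exists_antitone_density_of_concaveOn {g : ℝ → ℝ} (hg : ConcaveOn ℝ (Ioi 0) g)
    (hmono : MonotoneOn g (Ioi 0)) (h0 : ∀ u, 0 < u → 0 ≤ g u) :
    ∃ (ρ : ENNReal) (ψ : ℝ → ENNReal), Measurable ψ ∧ AntitoneOn ψ (Ioi 0) ∧
      ∀ u, 0 < u → ENNReal.ofReal (g u) = ρ + ∫⁻ s in Ioc 0 u, ψ s := by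
  set d : ℝ → ℝ := fun x => derivWithin g (Ioi x) x with hd
  have hneg : ConvexOn ℝ (Ioi 0) (-g) := hg.neg
  have hder : ∀ x, 0 < x → HasDerivWithinAt g (d x) (Ioi x) x := fun x hx => by
    have h := (hneg.hasDerivWithinAt_rightDeriv_of_mem_interior (x := x)
      (by rwa [interior_Ioi])).neg
    rw [neg_neg] at h
    exact h.differentiableWithinAt.hasDerivWithinAt
  have hdn : ∀ x, derivWithin (-g) (Ioi x) x = -d x := fun x => derivWithin.neg
  have hanti : AntitoneOn d (Ioi 0) := fun x hx y hy hxy => by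
    have := hneg.monotoneOn_rightDeriv (by rwa [interior_Ioi]) (by rwa [interior_Ioi]) hxy
    simp only [hdn] at this
    linarith
  have hdnn : ∀ x, 0 < x → 0 ≤ d x := fun x hx => by
    have h1 := hg.slope_le_rightDeriv (show x ∈ Ioi 0 from hx) (show x + 1 ∈ Ioi (0 : ℝ) by
      simp only [mem_Ioi]; linarith) (lt_add_one x) (hder x hx).differentiableWithinAt
    have h2 : 0 ≤ slope g x (x + 1) := by
      rw [slope_def_field]
      have := hmono (show x ∈ Ioi 0 from hx) (show x + 1 ∈ Ioi (0 : ℝ) by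
        simp only [mem_Ioi]; linarith) (lt_add_one x).le
      exact div_nonneg (by linarith) (by linarith)
    exact h2.trans h1
  have hcont : ContinuousOn g (Ioi 0) := hg.continuousOn isOpen_Ioi
  have hint : ∀ a u, 0 < a → a ≤ u →
      ENNReal.ofReal (g u) = ENNReal.ofReal (g a) + ∫⁻ s in Ioc a u, ENNReal.ofReal (d s) := by
    intro a u ha hau
    have hsub : uIcc a u ⊆ Ioi 0 := by
      rw [uIcc_of_le hau]; exact fun x hx => ha.trans_le hx.1
    have hi : IntervalIntegrable d volume a u := (hanti.mono hsub).intervalIntegrable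
    have hftc := intervalIntegral.integral_eq_sub_of_hasDeriv_right (hcont.mono hsub)
      (fun x hx => hder x (by rw [min_eq_left hau] at hx; exact ha.trans hx.1)) hi
    rw [intervalIntegral.integral_of_le hau] at hftc
    rw [← ofReal_integral_eq_lintegral_ofReal hi.1, hftc,
      ← ENNReal.ofReal_add (h0 a ha) (sub_nonneg.2 (hmono ha (ha.trans_le hau) hau))]
    · congr 1; ring
    · exact (ae_restrict_mem measurableSet_Ioc).mono fun x hx => hdnn x (ha.trans hx.1)
  let a : ℕ → ℝ := fun m => 1 / ((m : ℝ) + 1)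
  have ha : ∀ m, 0 < a m := fun m => by positivity
  have haa : Antitone a := fun m l hml =>
    one_div_le_one_div_of_le (by positivity) (by exact_mod_cast Nat.succ_le_succ hml)
  have hat : Tendsto a atTop (𝓝 0) := tendsto_one_div_add_atTop_nhds_zero_nat
  have hlim : Tendsto (fun m => ENNReal.ofReal (g (a m))) atTop
      (𝓝 (⨅ m, ENNReal.ofReal (g (a m)))) := tendsto_atTop_iInf fun m l hml =>
    ENNReal.ofReal_le_ofReal (hmono (ha l) (ha m) (haa hml))
  refine ⟨⨅ m, ENNReal.ofReal (g (a m)), fun x => ENNReal.ofReal (d x),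
    (measurable_derivWithin_Ioi g).ennreal_ofReal,
    fun x hx y hy hxy => ENNReal.ofReal_le_ofReal (hanti hx hy hxy), fun u hu => ?_⟩
  set ν := (volume : Measure ℝ).withDensity fun x => ENNReal.ofReal (d x) with hν
  have hνa : ∀ b, ν (Ioc b u) = ∫⁻ s in Ioc b u, ENNReal.ofReal (d s) := fun b =>
    withDensity_apply _ measurableSet_Ioc
  have hun : ⋃ m, Ioc (a m) u = Ioc 0 u := by
    ext y
    simp only [mem_iUnion, mem_Ioc]
    constructor
    · rintro ⟨m, h1, h2⟩; exact ⟨(ha m).trans h1, h2⟩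
    · rintro ⟨h1, h2⟩
      obtain ⟨m, hm⟩ := (hat.eventually_lt_const h1).exists
      exact ⟨m, hm, h2⟩
  have hν0 := tendsto_measure_iUnion_atTop (μ := ν) (s := fun m => Ioc (a m) u)
    fun m l hml => Ioc_subset_Ioc_left (haa hml)
  rw [hun, hνa] at hν0
  refine tendsto_nhds_unique (tendsto_const_nhds.congr' ?_) (hlim.add hν0)
  filter_upwards [hat.eventually_lt_const hu] with m hm
  simp only [Function.comp_apply, hνa]
  exact hint _ _ (ha m) hm.le

lemma demand_quantilePrice_ge (F : ProbabilityMeasure ℝ) {q p : ℝ} (hq : 0 < q)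
    (hp : q ≤ demand F p) : q ≤ demand F (quantilePrice F q) ∧ p ≤ quantilePrice F q := by
  have h := fun x => le_quantilePrice_iff' F (x := x) hq ⟨p, hp⟩
  exact ⟨(h _).1 le_rfl, (h _).2 hp⟩

lemma mul_quantilePrice_le (F : ProbabilityMeasure ℝ) {q p : ℝ} (hp : IsMonopolyReserve F p)
    (hq : 0 < q) (hqp : q ≤ demand F (quantilePrice F q)) :
    q * quantilePrice F q ≤ p * demand F p := by
  rcases le_total 0 (quantilePrice F q) with h | h
  · calc q * quantilePrice F q ≤ demand F (quantilePrice F q) * quantilePrice F q :=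
        mul_le_mul_of_nonneg_right hqp h
      _ ≤ _ := by rw [mul_comm]; exact hp.2 _
  · exact (mul_nonpos_of_nonneg_of_nonpos hq.le h).trans (mul_nonneg hp.1 (demand_nonneg F p))

lemma revenueCurve_eq (F : ProbabilityMeasure ℝ) (q : ℝ) :
    revenueCurve F q = q * quantilePrice F q := rfl

/-- Up to the monopoly quantile the ironed revenue curve is the revenue curve, beyond it is constant;
it is the distribution function of a measure that has, apart from a mass at the quantile `0`, a
non-increasing density. -/
lemma exists_ironed_density {F : ProbabilityMeasure ℝ} {p : ℝ} (hp : IsMonopolyReserve F p)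
    (hc : RevenueCurveConcaveAbove F p) :
    ∃ (ρ : ENNReal) (ψ : ℝ → ENNReal), Measurable ψ ∧ AntitoneOn ψ (Ioi 0) ∧
      ∀ u ∈ Ioo (0 : ℝ) 1,
        ENNReal.ofReal (u * quantilePrice F u) ≤ ρ + ∫⁻ s in Ioc 0 u, ψ s ∧
        ρ + ∫⁻ s in Ioc 0 u, ψ s ≤
          ENNReal.ofReal (min u (demand F p)) * ENNReal.ofReal (max p (quantilePrice F u)) := by
  set Q := demand F p with hQ
  have hQ0 : 0 ≤ Q := demand_nonneg F p
  have hr0 : revenueCurve F 0 = 0 := by simp [revenueCurve]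
  have hle : ∀ q, 0 < q → q ≤ Q → revenueCurve F q ≤ p * Q := fun q hq hqQ =>
    mul_quantilePrice_le F hp hq (demand_quantilePrice_ge F hq hqQ).1
  have hnn : ∀ q, 0 ≤ q → q ≤ Q → 0 ≤ revenueCurve F q := fun q hq hqQ => by
    rcases hq.eq_or_lt with rfl | hq
    · exact hr0.ge
    · exact mul_nonneg hq.le (hp.1.trans (demand_quantilePrice_ge F hq hqQ).2)
  have hrQ : revenueCurve F Q = p * Q := by
    rcases hQ0.eq_or_lt with h | h
    · rw [← h, hr0, mul_zero]
    · refine le_antisymm (hle Q h le_rfl) ?_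
      rw [revenueCurve_eq, mul_comm]
      exact mul_le_mul_of_nonneg_left (demand_quantilePrice_ge F h le_rfl).2 hQ0
  have hle' : ∀ q, 0 ≤ q → q ≤ Q → revenueCurve F q ≤ revenueCurve F Q := fun q hq hqQ => by
    rcases hq.eq_or_lt with rfl | hq
    · rw [hr0]; exact hnn Q hQ0 le_rfl
    · rw [hrQ]; exact hle q hq hqQ
  -- A concave function that attains its maximum at the right endpoint is non-decreasing.
  have hrmono : MonotoneOn (revenueCurve F) (Icc 0 Q) := fun x hx y hy hxy => by
    have := hc.min_le_of_mem_Icc hx ⟨hQ0, le_rfl⟩ (z := y) ⟨hxy, hy.2⟩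
    rwa [min_eq_left (hle' x hx.1 hx.2)] at this
  have hmin : ∀ u, 0 < u → min u Q ∈ Icc 0 Q := fun u hu => ⟨le_min hu.le hQ0, min_le_right _ _⟩
  set g : ℝ → ℝ := fun u => revenueCurve F (min u Q) with hg
  have gmono : MonotoneOn g (Ioi 0) := fun x hx y hy hxy =>
    hrmono (hmin x hx) (hmin y hy) (min_le_min_right _ hxy)
  -- A non-decreasing concave function composed with the concave map `min u Q`.
  have gconc : ConcaveOn ℝ (Ioi 0) g := by
    refine ⟨convex_Ioi 0, fun x hx y hy a b ha hb hab => ?_⟩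
    refine (hc.2 (hmin x hx) (hmin y hy) ha hb hab).trans ?_
    have hxy : 0 < a • x + b • y := (convex_Ioi (0 : ℝ)) hx hy ha hb hab
    refine hrmono ((convex_Icc (0 : ℝ) Q) (hmin x hx) (hmin y hy) ha hb hab) (hmin _ hxy) ?_
    simp only [smul_eq_mul]
    refine le_min ?_ ?_
    · exact add_le_add (mul_le_mul_of_nonneg_left (min_le_left _ _) ha)
        (mul_le_mul_of_nonneg_left (min_le_left _ _) hb)
    · calc _ ≤ a * Q + b * Q := add_le_add (mul_le_mul_of_nonneg_left (min_le_right _ _) ha)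
            (mul_le_mul_of_nonneg_left (min_le_right _ _) hb)
        _ = Q := by rw [← add_mul, hab, one_mul]
  obtain ⟨ρ, ψ, hψ, hanti, hρ⟩ := exists_antitone_density_of_concaveOn gconc gmono
    fun u hu => hnn _ (hmin u hu).1 (hmin u hu).2
  refine ⟨ρ, ψ, hψ, hanti, fun u hu => ?_⟩
  rw [← hρ u hu.1, ← ENNReal.ofReal_mul (hmin u hu.1).1]
  have hV : u ≤ demand F (quantilePrice F u) := (le_quantilePrice_iff F hu).1 le_rfl
  rcases le_or_gt u Q with h | h
  · simp only [hg, min_eq_left h, revenueCurve_eq]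
    exact ⟨le_rfl, ENNReal.ofReal_le_ofReal
      (mul_le_mul_of_nonneg_left (le_max_right _ _) hu.1.le)⟩
  · simp only [hg, min_eq_right h.le, hrQ]
    refine ⟨ENNReal.ofReal_le_ofReal (mul_quantilePrice_le F hp hu.1 hV),
      ENNReal.ofReal_le_ofReal ?_⟩
    rw [mul_comm]
    exact mul_le_mul_of_nonneg_left (le_max_left _ _) hQ0

end ConcaveRevenue

/-! ### Incentive compatibility for one buyer: envelope bound and payment bound. -/

section SingleBuyer

open Set Filter Topology

variable {a t : ℝ → ℝ}

lemma monotone_of_ic (hic : ∀ x y, x * a y - t y ≤ x * a x - t x) : Monotone a := by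
  intro x y hxy
  rcases hxy.eq_or_lt with rfl | hlt
  · exact le_rfl
  · have h1 := hic x y
    have h2 := hic y x
    by_contra! hc
    nlinarith [mul_pos (sub_pos.2 hlt) (sub_pos.2 hc)]

/-- A function is non-decreasing over an interval if its decrements are controlled, to second order,
by the increments of some function. -/
lemma le_of_forall_increment {H e : ℝ → ℝ} {x y : ℝ} (hxy : x ≤ y)
    (h : ∀ z w, x ≤ z → z ≤ w → w ≤ y → (w - z) * (e z - e w) ≤ H w - H z) : H x ≤ H y := by
  -- On a subdivision into `N + 1` equal pieces the error terms telescope to `(y - x) * (e x - e y)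
  -- / (N + 1)`, which vanishes in the limit. No differentiability is needed.
  have key : ∀ N : ℕ, H x ≤ H y - (y - x) * (e x - e y) * (1 / ((N : ℝ) + 1)) := by
    intro N
    have hN : (0 : ℝ) < (N : ℝ) + 1 := by positivity
    set δ : ℝ := (y - x) / ((N : ℝ) + 1) with hδ
    have h0 : 0 ≤ δ := div_nonneg (by linarith) hN.le
    set c : ℕ → ℝ := fun j => x + j * δ with hc
    have hcs : ∀ j, c (j + 1) = c j + δ := fun j => by simp only [hc]; push_cast; ring
    have hcN : c (N + 1) = y := by
      simp only [hc, hδ]; push_cast; field_simp; ring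
    have hc0 : c 0 = x := by simp [hc]
    have hcx : ∀ j, x ≤ c j := fun j => by simp only [hc]; nlinarith [mul_nonneg j.cast_nonneg h0]
    have hcm : Monotone c := monotone_nat_of_le_succ fun j => by rw [hcs]; linarith
    have hsum : ∑ j ∈ Finset.range (N + 1), δ * (e (c j) - e (c (j + 1))) ≤
        ∑ j ∈ Finset.range (N + 1), (H (c (j + 1)) - H (c j)) :=
      Finset.sum_le_sum fun j hj => by
        have := h (c j) (c (j + 1)) (hcx j) (hcm (Nat.le_succ j))
          (hcN ▸ hcm (Finset.mem_range.1 hj))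
        rwa [hcs, add_sub_cancel_left, ← hcs] at this
    rw [← Finset.mul_sum, Finset.sum_range_sub' (fun j => e (c j)),
      Finset.sum_range_sub (fun j => H (c j)), hcN, hc0] at hsum
    have : δ * (e x - e y) = (y - x) * (e x - e y) * (1 / ((N : ℝ) + 1)) := by rw [hδ]; ring
    linarith
  have hlim : Tendsto (fun N : ℕ => H y - (y - x) * (e x - e y) * (1 / ((N : ℝ) + 1))) atTop
      (𝓝 (H y - (y - x) * (e x - e y) * 0)) :=
    tendsto_const_nhds.sub (tendsto_const_nhds.mul tendsto_one_div_add_atTop_nhds_zero_nat)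
  rw [mul_zero, sub_zero] at hlim
  exact ge_of_tendsto' hlim key

/-- The envelope bound: truthful utility dominates the integral of the allocation. -/
lemma integral_alloc_le_utility (hic : ∀ x y, x * a y - t y ≤ x * a x - t x)
    (hir : ∀ x, 0 ≤ x * a x - t x) {x : ℝ} (hx : 0 ≤ x) :
    ∫ s in (0 : ℝ)..x, a s ≤ x * a x - t x := by
  have hmono := monotone_of_ic hic
  have hii : ∀ z w, IntervalIntegrable a volume z w := fun _ _ => hmono.intervalIntegrable
  -- From `z` to `w` the utility grows by at least `(w - z) * a z`, and the integral by at most `(w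
  -- - z) * a w`.
  have := le_of_forall_increment (H := fun y => y * a y - t y - ∫ s in (0 : ℝ)..y, a s) (e := a) hx
    fun z w _ hzw _ => by
      have e1 : ∫ s in z..w, a s ≤ ∫ s in z..w, a w :=
        intervalIntegral.integral_mono_on hzw (hii z w) (by simp) fun s hs => hmono hs.2
      rw [intervalIntegral.integral_const, smul_eq_mul] at e1
      have e2 := intervalIntegral.integral_add_adjacent_intervals (hii 0 z) (hii z w)
      have e3 := hic w z
      linarith
  have h0 := hir 0
  simp only [intervalIntegral.integral_same] at this
  linarith

/-- For `x ≤ 0` individual rationality makes the payment nonpositive; for `x > 0` this is the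
envelope bound. Truncation by `ENNReal.ofReal` discards all `s` beyond `x`, so the domain of
integration need not depend on `x`. -/
lemma payment_le (hic : ∀ x y, x * a y - t y ≤ x * a x - t x) (hir : ∀ x, 0 ≤ x * a x - t x)
    (ha : ∀ x, 0 ≤ a x) (x : ℝ) :
    ENNReal.ofReal (t x) ≤ ∫⁻ s in Ioi (0 : ℝ), ENNReal.ofReal (a x - a s) := by
  have hmono := monotone_of_ic hic
  rcases le_or_gt x 0 with hx | hx
  · rw [ENNReal.ofReal_of_nonpos]
    · exact zero_le
    · have := hir x
      have := mul_nonpos_of_nonpos_of_nonneg hx (ha x)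
      linarith
  · have hi : IntervalIntegrable (fun s => a x - a s) volume 0 x :=
      (intervalIntegrable_const).sub hmono.intervalIntegrable
    have h1 : t x ≤ ∫ s in (0 : ℝ)..x, (a x - a s) := by
      rw [intervalIntegral.integral_sub intervalIntegrable_const hmono.intervalIntegrable,
        intervalIntegral.integral_const, smul_eq_mul, sub_zero]
      have := integral_alloc_le_utility hic hir hx.le
      linarith
    refine (ENNReal.ofReal_le_ofReal h1).trans ?_
    rw [intervalIntegral.integral_of_le hx.le, ofReal_integral_eq_lintegral_ofReal hi.1]
    · exact lintegral_mono_set Ioc_subset_Ioi_self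
    · exact (ae_restrict_mem measurableSet_Ioc).mono fun s hs => sub_nonneg.2 (hmono hs.2)

/-- The expected payment of a buyer is at most her ironed virtual surplus, plus the revenue at the
quantile `0`. -/
lemma lintegral_payment_le (hmono : Monotone a) (ha0 : ∀ x, 0 ≤ a x) (ha1 : ∀ x, a x ≤ 1)
    {V : ℝ → ℝ} (hVm : Measurable V) (hV : AntitoneOn V (Ioo 0 1)) {ρ : ENNReal} {ψ : ℝ → ENNReal}
    (hψ : Measurable ψ)
    (h : ∀ u ∈ Ioo (0 : ℝ) 1, ENNReal.ofReal (u * V u) ≤ ρ + ∫⁻ s in Ioc 0 u, ψ s) :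
    ∫⁻ u, (∫⁻ s in Ioi (0 : ℝ), ENNReal.ofReal (a (V u) - a s)) ∂uniform ≤
      ρ + ∫⁻ u, ψ u * ENNReal.ofReal (a (V u)) ∂uniform := by
  have ham : Measurable a := hmono.measurable
  -- The allocation is a mixture over levels `θ` of posted prices: at level `θ` the buyer is served
  -- when `θ ≤ a (V u)`, at the price given by the length of the positive values with `a s < θ`.
  let f : ℝ → ℝ → ENNReal := fun u θ => {x : ℝ × ℝ | x.2 ≤ a (V x.1)}.indicator 1 (u, θ)
  let g : ℝ → ℝ → ENNReal := fun s θ => {x : ℝ × ℝ | a x.1 < x.2}.indicator 1 (s, θ)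
  have hf : Measurable (Function.uncurry f) := measurable_one.indicator
    (measurableSet_le measurable_snd (ham.comp (hVm.comp measurable_fst)))
  have hg : Measurable (Function.uncurry g) := measurable_one.indicator
    (measurableSet_lt (ham.comp measurable_fst) measurable_snd)
  have hf1 : ∀ θ, Measurable fun u => f u θ := fun θ => hf.comp (measurable_id.prodMk measurable_const)
  have hg1 : ∀ θ, Measurable fun s => g s θ := fun θ => hg.comp (measurable_id.prodMk measurable_const)
  set lev : Measure ℝ := volume.restrict (Ioc 0 1) with hlev
  have hsplit : ∀ u s, ENNReal.ofReal (a (V u) - a s) = ∫⁻ θ, f u θ * g s θ ∂lev := by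
    intro u s
    have : ∀ θ, f u θ * g s θ = (Ioc (a s) (a (V u))).indicator 1 θ := fun θ => by
      simp only [f, g, indicator_apply, mem_ofPred_eq, mem_Ioc, Pi.one_apply]
      by_cases h1 : θ ≤ a (V u) <;> by_cases h2 : a s < θ <;> simp [h1, h2]
    simp_rw [this]
    rw [lintegral_indicator_one measurableSet_Ioc, hlev, Measure.restrict_apply measurableSet_Ioc,
      inter_eq_left.2 (Ioc_subset_Ioc (ha0 s) (ha1 _)), Real.volume_Ioc]
  have hfa : ∀ u, ENNReal.ofReal (a (V u)) = ∫⁻ θ, f u θ ∂lev := by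
    intro u
    have : ∀ θ, f u θ = (Iic (a (V u))).indicator 1 θ := fun θ => rfl
    simp_rw [this]
    rw [lintegral_indicator_one measurableSet_Iic, hlev, Measure.restrict_apply measurableSet_Iic,
      inter_comm, Ioc_inter_Iic, min_eq_right (ha1 _), Real.volume_Ioc, sub_zero]
  have hgm : Measurable fun θ => ∫⁻ s in Ioi (0 : ℝ), g s θ :=
    Measurable.lintegral_prod_left' (f := Function.uncurry g) hg
  have hlevel : ∀ θ, (∫⁻ u, f u θ ∂uniform) * (∫⁻ s in Ioi (0 : ℝ), g s θ) ≤
      ρ + ∫⁻ u, ψ u * f u θ ∂uniform := by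
    intro θ
    set E : Set ℝ := {u | θ ≤ a (V u)} with hE
    have hEm : MeasurableSet E := measurableSet_le measurable_const (ham.comp hVm)
    have hfE : ∫⁻ u, f u θ ∂uniform = uniform E := by
      rw [← lintegral_indicator_one hEm]; rfl
    rw [hfE]
    -- A sale probability `q` strictly below that of `E` avoids deciding whether the endpoint
    -- belongs to `E`: monotonicity forces `E` to contain all of `(0, u]`, so the price is at most
    -- `V u`.
    refine ENNReal.mul_le_of_forall_lt fun q hq L hL => ?_
    have hq1 : q < 1 := hq.trans_le prob_le_one
    rcases eq_or_ne q 0 with rfl | hq0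
    · simp
    have hqt : q ≠ ⊤ := (hq1.trans ENNReal.one_lt_top).ne
    set u := q.toReal with hu
    have hqu : q = ENNReal.ofReal u := (ENNReal.ofReal_toReal hqt).symm
    have hu0 : 0 < u := ENNReal.toReal_pos hq0 hqt
    have hu1 : u < 1 := by
      rw [← ENNReal.ofReal_lt_ofReal_iff one_pos, ← hqu, ENNReal.ofReal_one]; exact hq1
    have huE : ∀ w ∈ Ioc 0 u, w ∈ E := by
      intro w hw
      have hw1 : w < 1 := hw.2.trans_lt hu1
      by_contra hcon
      have hcon : a (V w) < θ := not_le.1 hcon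
      refine absurd hq (not_lt.2 ?_)
      calc uniform E ≤ uniform (Iic u) := by
            refine measure_mono_ae ?_
            filter_upwards [ae_uniform_mem] with z hz
            intro hzE
            by_contra! hlt
            have hwz : w ≤ z := hw.2.trans (not_le.1 hlt).le
            have h2 := hmono (hV ⟨hw.1, hw1⟩ hz hwz)
            exact absurd (le_trans (show θ ≤ a (V z) from hzE) h2) (not_le.2 hcon)
        _ = q := by rw [uniform_Iic hu1.le, hqu]
    have hLV : ∫⁻ s in Ioi (0 : ℝ), g s θ ≤ ENNReal.ofReal (V u) := by
      have hgE : ∀ s, g s θ = {s | a s < θ}.indicator 1 s := fun s => rfl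
      simp_rw [hgE]
      rw [lintegral_indicator_one (measurableSet_lt ham measurable_const),
        Measure.restrict_apply (measurableSet_lt ham measurable_const)]
      calc volume ({s | a s < θ} ∩ Ioi 0) ≤ volume (Ioo 0 (V u)) := by
            refine measure_mono fun s hs => ⟨hs.2, ?_⟩
            by_contra! hle
            have h1 : a s < θ := hs.1
            have h2 : θ ≤ a (V u) := huE u ⟨hu0, le_rfl⟩
            exact absurd (h2.trans (hmono hle)) (not_le.2 h1)
        _ = _ := by rw [Real.volume_Ioo, sub_zero]
    calc q * L ≤ ENNReal.ofReal u * ENNReal.ofReal (V u) := by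
          rw [hqu]; exact mul_le_mul_right (hL.le.trans hLV) _
      _ = ENNReal.ofReal (u * V u) := (ENNReal.ofReal_mul hu0.le).symm
      _ ≤ ρ + ∫⁻ s in Ioc 0 u, ψ s := h u ⟨hu0, hu1⟩
      _ ≤ _ := by
          refine add_le_add le_rfl ?_
          rw [uniform, ← lintegral_indicator measurableSet_Ioc, ← lintegral_indicator measurableSet_Ioo]
          refine lintegral_mono fun s => ?_
          by_cases hs : s ∈ Ioc 0 u
          · have hfs : f s θ = 1 := indicator_of_mem (show (s, θ) ∈ {x : ℝ × ℝ | x.2 ≤ a (V x.1)}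
              from huE s hs) _
            rw [indicator_of_mem hs,
              indicator_of_mem (show s ∈ Ioo (0 : ℝ) 1 from ⟨hs.1, hs.2.trans_lt hu1⟩), hfs, mul_one]
          · rw [indicator_of_notMem hs]; exact zero_le
  calc ∫⁻ u, (∫⁻ s in Ioi (0 : ℝ), ENNReal.ofReal (a (V u) - a s)) ∂uniform
      = ∫⁻ u, ∫⁻ θ, f u θ * (∫⁻ s in Ioi (0 : ℝ), g s θ) ∂lev ∂uniform := by
        refine lintegral_congr fun u => ?_
        simp_rw [hsplit]
        rw [lintegral_lintegral_swap]
        · exact lintegral_congr fun θ => lintegral_const_mul _ (hg1 θ)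
        · refine Measurable.aemeasurable ?_
          exact (hf.comp (measurable_const.prodMk measurable_snd)).mul hg
    _ = ∫⁻ θ, (∫⁻ u, f u θ ∂uniform) * (∫⁻ s in Ioi (0 : ℝ), g s θ) ∂lev := by
        rw [lintegral_lintegral_swap]
        · exact lintegral_congr fun θ => lintegral_mul_const _ (hf1 θ)
        · exact (hf.mul (hgm.comp measurable_snd)).aemeasurable
    _ ≤ ∫⁻ θ, (ρ + ∫⁻ u, ψ u * f u θ ∂uniform) ∂lev := lintegral_mono hlevel
    _ = ρ + ∫⁻ θ, ∫⁻ u, ψ u * f u θ ∂uniform ∂lev := by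
        rw [lintegral_add_left measurable_const, lintegral_const]
        simp [hlev]
    _ = ρ + ∫⁻ u, ψ u * ENNReal.ofReal (a (V u)) ∂uniform := by
        congr 1
        rw [lintegral_lintegral_swap]
        · refine lintegral_congr fun u => ?_
          rw [hfa, lintegral_const_mul]
          exact hf.comp (measurable_const.prodMk measurable_id)
        · exact ((hψ.comp measurable_snd).mul (hf.comp measurable_swap)).aemeasurable

end SingleBuyer

/-! ### Optimality of the monopoly reserve against i.i.d. values. -/

section Myerson

open Set Filter Topology

variable {n : ℕ}

lemma measurable_update_pair (i : Fin n) :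
    Measurable fun x : (Fin n → ℝ) × ℝ => Function.update x.1 i x.2 := by
  refine measurable_pi_iff.2 fun j => ?_
  rcases eq_or_ne j i with rfl | h
  · simpa using measurable_snd
  · simp only [Function.update_of_ne h]
    exact (measurable_pi_apply j).comp measurable_fst

lemma measurePreserving_update (μ : Measure ℝ) [IsProbabilityMeasure μ] (i : Fin n) :
    MeasurePreserving (fun x : (Fin n → ℝ) × ℝ => Function.update x.1 i x.2)
      ((Measure.pi fun _ => μ).prod μ) (Measure.pi fun _ => μ) := by
  refine ⟨measurable_update_pair i, (Measure.pi_eq fun s hs => ?_).symm⟩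
  rw [Measure.map_apply (measurable_update_pair i) (MeasurableSet.univ_pi hs)]
  have : (fun x : (Fin n → ℝ) × ℝ => Function.update x.1 i x.2) ⁻¹' univ.pi s =
      (univ.pi (Function.update s i univ)) ×ˢ s i := by
    ext ⟨v, y⟩
    simp only [mem_preimage, Set.mem_pi, mem_univ, true_imp_iff, mem_prod]
    constructor
    · intro h
      refine ⟨fun j => ?_, by simpa using h i⟩
      rcases eq_or_ne j i with rfl | hj
      · simp
      · simpa [hj] using h j
    · rintro ⟨h, hy⟩ j
      rcases eq_or_ne j i with rfl | hj
      · simpa using hy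
      · simpa [hj] using h j
  rw [this, Measure.prod_prod, Measure.pi_pi, ← Finset.mul_prod_erase _ _ (Finset.mem_univ i),
    ← Finset.mul_prod_erase Finset.univ (fun j => μ (s j)) (Finset.mem_univ i), Function.update_self,
    measure_univ, one_mul, mul_comm]
  congr 1
  exact Finset.prod_congr rfl fun j hj => by rw [Function.update_of_ne (Finset.ne_of_mem_erase hj)]

/-- Redrawing one coordinate does not change the expectation. -/
lemma lintegral_pi_eq_lintegral_update (μ : Measure ℝ) [IsProbabilityMeasure μ] (i : Fin n)
    {f : (Fin n → ℝ) → ENNReal} (hf : Measurable f) :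
    ∫⁻ x, f x ∂(Measure.pi fun _ => μ) =
      ∫⁻ x, ∫⁻ y, f (Function.update x i y) ∂μ ∂(Measure.pi fun _ => μ) := by
  rw [← (measurePreserving_update μ i).lintegral_comp hf, lintegral_prod]
  exact (hf.comp (measurable_update_pair i)).aemeasurable

/-- The highest price accepted with probability at least `q`, for `0 < q < 1`. -/
noncomputable def valueAt (F : ProbabilityMeasure ℝ) : ℝ → ℝ :=
  (Ioo (0 : ℝ) 1).indicator (quantilePrice F)

lemma valueAt_of_mem (F : ProbabilityMeasure ℝ) {q : ℝ} (hq : q ∈ Ioo (0 : ℝ) 1) :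
    valueAt F q = quantilePrice F q := indicator_of_mem hq _

lemma le_valueAt_iff (F : ProbabilityMeasure ℝ) {q x : ℝ} (hq : q ∈ Ioo (0 : ℝ) 1) :
    x ≤ valueAt F q ↔ q ≤ demand F x := by
  rw [valueAt_of_mem F hq, le_quantilePrice_iff F hq]

lemma valueAt_antitoneOn (F : ProbabilityMeasure ℝ) : AntitoneOn (valueAt F) (Ioo 0 1) :=
  fun a ha b hb hab => by
    rw [valueAt_of_mem F ha, valueAt_of_mem F hb]
    exact quantilePrice_antitoneOn F ha hb hab

lemma measurable_valueAt (F : ProbabilityMeasure ℝ) : Measurable (valueAt F) := by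
  refine measurable_of_Ici fun x => ?_
  have : valueAt F ⁻¹' Ici x =
      (Ioo 0 1 ∩ Iic (demand F x)) ∪ ((Ioo (0 : ℝ) 1)ᶜ ∩ {_q | x ≤ 0}) := by
    ext q
    by_cases hq : q ∈ Ioo (0 : ℝ) 1
    · simp only [mem_preimage, mem_Ici, le_valueAt_iff F hq, mem_union, mem_inter_iff, hq, true_and,
        mem_Iic, mem_compl_iff, not_true, false_and, or_false]
    · simp only [mem_preimage, mem_Ici, valueAt, indicator_of_notMem hq, mem_union, mem_inter_iff,
        hq, false_and, mem_compl_iff, not_false_iff, true_and, false_or, mem_ofPred_eq]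
  rw [this]
  exact (measurableSet_Ioo.inter measurableSet_Iic).union
    (measurableSet_Ioo.compl.inter (MeasurableSet.const _))

lemma map_valueAt (F : ProbabilityMeasure ℝ) : uniform.map (valueAt F) = (F : Measure ℝ) := by
  have hp : IsProbabilityMeasure (uniform.map (valueAt F)) :=
    Measure.isProbabilityMeasure_map (measurable_valueAt F).aemeasurable
  refine Measure.ext_of_Ici _ _ fun x => ?_
  rw [Measure.map_apply (measurable_valueAt F) measurableSet_Ici]
  have : uniform (valueAt F ⁻¹' Ici x) = uniform (Iic (demand F x)) := by
    refine measure_congr ?_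
    filter_upwards [ae_uniform_mem] with q hq
    exact propext (le_valueAt_iff F hq)
  rw [this, uniform_Iic (demand_le_one F x), demand, measureReal_def,
    ENNReal.ofReal_toReal (measure_ne_top _ _)]

/-- The joint distribution of the quantiles of the buyers. -/
noncomputable def quantileLaw (n : ℕ) : Measure (Fin n → ℝ) := Measure.pi fun _ => uniform

instance : IsProbabilityMeasure (quantileLaw n) := by unfold quantileLaw; infer_instance

/-- The valuation profile of a profile of quantiles. -/
noncomputable def values (F : ProbabilityMeasure ℝ) (q : Fin n → ℝ) : Fin n → ℝ :=
  fun j => valueAt F (q j)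

lemma measurable_values (F : ProbabilityMeasure ℝ) :
    Measurable (values F : (Fin n → ℝ) → Fin n → ℝ) :=
  measurable_pi_iff.2 fun j => (measurable_valueAt F).comp (measurable_pi_apply j)

lemma values_update (F : ProbabilityMeasure ℝ) (q : Fin n → ℝ) (i : Fin n) (u : ℝ) :
    values F (Function.update q i u) = Function.update (values F q) i (valueAt F u) := by
  funext j
  rcases eq_or_ne j i with rfl | h
  · simp [values]
  · simp [values, h]

lemma profileLaw_iid_eq_map (F : ProbabilityMeasure ℝ) :
    profileLaw (iid n F) = (quantileLaw n).map (values F) := by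
  have h : ∀ _ : Fin n, SigmaFinite (uniform.map (valueAt F)) := fun _ => by
    rw [map_valueAt]; infer_instance
  have := Measure.pi_map_pi (μ := fun _ : Fin n => uniform) (f := fun _ => valueAt F)
    fun _ => (measurable_valueAt F).aemeasurable
  rw [quantileLaw]
  change _ = Measure.map (fun (q : Fin n → ℝ) j => valueAt F (q j)) _
  rw [this, map_valueAt]
  rfl

lemma lintegral_quantileLaw_update (i : Fin n) {f : (Fin n → ℝ) → ENNReal} (hf : Measurable f) :
    ∫⁻ q, f q ∂quantileLaw n =
      ∫⁻ q, ∫⁻ u, f (Function.update q i u) ∂uniform ∂quantileLaw n :=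
  lintegral_pi_eq_lintegral_update uniform i hf

lemma ae_quantileLaw_mem : ∀ᵐ q ∂quantileLaw n, ∀ i, q i ∈ Ioo (0 : ℝ) 1 :=
  ae_all_iff.2 fun i =>
    (measurePreserving_eval (fun _ : Fin n => uniform) i).quasiMeasurePreserving.ae ae_uniform_mem

/-- Values tie when `F` has atoms, but quantiles almost surely do not, so a strictly strongest buyer
exists almost surely. -/
lemma ae_quantileLaw_injective : ∀ᵐ q ∂quantileLaw n, ∀ i j, i ≠ j → q i ≠ q j := by
  refine ae_all_iff.2 fun i => ae_all_iff.2 fun j => ?_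
  by_cases hij : i = j
  · exact Eventually.of_forall fun q h => absurd hij h
  have hm : MeasurableSet {q : Fin n → ℝ | q i = q j} :=
    measurableSet_eq_fun (measurable_pi_apply i) (measurable_pi_apply j)
  have h0 : quantileLaw n {q : Fin n → ℝ | q i = q j} = 0 := by
    rw [← lintegral_indicator_one hm,
      lintegral_quantileLaw_update i (measurable_one.indicator hm), lintegral_eq_zero_iff']
    · refine Eventually.of_forall fun q => ?_
      have : ∀ u, ({q : Fin n → ℝ | q i = q j}.indicator 1 (Function.update q i u) : ENNReal) =
          ({q j} : Set ℝ).indicator 1 u := fun u => by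
        have hji : j ≠ i := fun h => hij h.symm
        simp [indicator_apply, hji]
      simp_rw [this]
      rw [lintegral_indicator_one (measurableSet_singleton _)]
      simp [uniform]
    · have hj := ((measurable_one.indicator hm : Measurable
        ({q : Fin n → ℝ | q i = q j}.indicator (1 : (Fin n → ℝ) → ENNReal)))).comp
        (measurable_update_pair i)
      exact (Measurable.lintegral_prod_right' hj).aemeasurable
  have := measure_eq_zero_iff_ae_notMem.1 h0
  exact this.mono fun q hq _ h => hq h

/-- The payment of buyer `i` that makes her allocation incentive compatible, for nonnegative
values. -/
noncomputable def envelopePayment (M : Mechanism n) (i : Fin n) (v : Fin n → ℝ) : ENNReal :=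
  ∫⁻ s in Ioi (0 : ℝ), ENNReal.ofReal (M.alloc v i - M.alloc (Function.update v i s) i)

lemma measurable_envelopePayment (M : Mechanism n) (i : Fin n) :
    Measurable (envelopePayment M i) := by
  have : Measurable fun x : (Fin n → ℝ) × ℝ =>
      ENNReal.ofReal (M.alloc x.1 i - M.alloc (Function.update x.1 i x.2) i) :=
    (((M.measurable_alloc i).comp measurable_fst).sub
      ((M.measurable_alloc i).comp (measurable_update_pair i))).ennreal_ofReal
  exact this.lintegral_prod_right'

lemma Mechanism.IsDSIC.ic {M : Mechanism n} (hM : M.IsDSIC) (v : Fin n → ℝ) (i : Fin n) (x y : ℝ) :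
    x * M.alloc (Function.update v i y) i - M.pay (Function.update v i y) i ≤
      x * M.alloc (Function.update v i x) i - M.pay (Function.update v i x) i := by
  have := hM (Function.update v i x) i y
  simpa [Mechanism.utility] using this

lemma Mechanism.IsIR.ir {M : Mechanism n} (hM : M.IsIR) (v : Fin n → ℝ) (i : Fin n) (x : ℝ) :
    0 ≤ x * M.alloc (Function.update v i x) i - M.pay (Function.update v i x) i := by
  have := hM (Function.update v i x) i
  simpa [Mechanism.utility] using this

lemma Mechanism.alloc_le_one (M : Mechanism n) (v : Fin n → ℝ) (i : Fin n) : M.alloc v i ≤ 1 :=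
  (Finset.single_le_sum (fun j _ => M.alloc_nonneg v j) (Finset.mem_univ i)).trans
    (M.sum_alloc_le_one v)

lemma ofReal_pay_le {M : Mechanism n} (hd : M.IsDSIC) (hi : M.IsIR) (v : Fin n → ℝ) (i : Fin n) :
    ENNReal.ofReal (M.pay v i) ≤ envelopePayment M i v := by
  have := payment_le (a := fun s => M.alloc (Function.update v i s) i)
    (t := fun s => M.pay (Function.update v i s) i) (hd.ic v i) (hi.ir v i)
    (fun s => M.alloc_nonneg _ i) (v i)
  simpa [envelopePayment] using this

/-- The expected payment of a buyer is at most her ironed virtual surplus, plus the revenue at the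
quantile `0`. -/
lemma lintegral_envelopePayment_le {M : Mechanism n} (hd : M.IsDSIC) (F : ProbabilityMeasure ℝ)
    {ρ : ENNReal} {ψ : ℝ → ENNReal} (hψ : Measurable ψ)
    (h : ∀ u ∈ Ioo (0 : ℝ) 1, ENNReal.ofReal (u * quantilePrice F u) ≤ ρ + ∫⁻ s in Ioc 0 u, ψ s)
    (i : Fin n) :
    ∫⁻ q, envelopePayment M i (values F q) ∂quantileLaw n ≤
      ρ + ∫⁻ q, ψ (q i) * ENNReal.ofReal (M.alloc (values F q) i) ∂quantileLaw n := by
  have hψa : Measurable fun q : Fin n → ℝ =>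
      ψ (q i) * ENNReal.ofReal (M.alloc (values F q) i) :=
    (hψ.comp (measurable_pi_apply i)).mul
      ((M.measurable_alloc i).comp (measurable_values F)).ennreal_ofReal
  rw [lintegral_quantileLaw_update (f := fun q => envelopePayment M i (values F q)) i
      ((measurable_envelopePayment M i).comp (measurable_values F)),
    lintegral_quantileLaw_update i hψa]
  calc _ ≤ ∫⁻ q, (ρ + ∫⁻ u, ψ (Function.update q i u i) * ENNReal.ofReal
          (M.alloc (values F (Function.update q i u)) i) ∂uniform) ∂quantileLaw n := by
        refine lintegral_mono fun q => ?_
        simp only [values_update, Function.update_self, envelopePayment, Function.update_idem]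
        refine lintegral_payment_le
          (a := fun s => M.alloc (Function.update (values F q) i s) i)
          (monotone_of_ic (hd.ic (values F q) i)) (fun _ => M.alloc_nonneg _ i)
          (fun _ => M.alloc_le_one _ i) (measurable_valueAt F) (valueAt_antitoneOn F) hψ
          fun u hu => ?_
        rw [valueAt_of_mem F hu]
        exact h u hu
    _ = _ := by
        rw [lintegral_add_left measurable_const, lintegral_const, measure_univ, mul_one]

/-- Profiles of quantiles at which buyer `i` has the highest value, strictly. -/
def strongest (i : Fin n) : Set (Fin n → ℝ) := {q | ∀ j, j ≠ i → q i < q j}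

lemma measurableSet_strongest (i : Fin n) : MeasurableSet (strongest i) := by
  have : (strongest i : Set (Fin n → ℝ)) = ⋂ j, ⋂ (_ : j ≠ i), {q | q i < q j} := by
    ext; simp [strongest]
  rw [this]
  exact MeasurableSet.iInter fun j => MeasurableSet.iInter fun _ =>
    measurableSet_lt (measurable_pi_apply i) (measurable_pi_apply j)

/-- The part of the revenue of the second-price auction that is collected from buyer `i`. -/
noncomputable def reservePayment (F : ProbabilityMeasure ℝ) (p : ℝ) (i : Fin n) (q : Fin n → ℝ) :
    ENNReal :=
  (strongest i ∩ {q | q i ≤ demand F p}).indicator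
    (fun q => ENNReal.ofReal (max p (orderStat 2 (values F q)))) q

lemma measurable_reservePayment (F : ProbabilityMeasure ℝ) (p : ℝ) (i : Fin n) :
    Measurable (reservePayment F p i) :=
  (measurable_const.max ((measurable_orderStat 2).comp (measurable_values F))).ennreal_ofReal.indicator
    ((measurableSet_strongest i).inter (measurableSet_le (measurable_pi_apply i) measurable_const))

/-- At most one buyer is strongest. The total payment depends only on order statistics, so the
tie-breaking rule plays no role. -/
lemma sum_reservePayment_le (F : ProbabilityMeasure ℝ) (p : ℝ) {q : Fin n → ℝ}
    (hq : ∀ i, q i ∈ Ioo (0 : ℝ) 1) :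
    ∑ i, reservePayment F p i q ≤ ENNReal.ofReal ((SPA n p).totalPay (values F q)) := by
  by_cases h : ∃ i, q ∈ strongest i ∩ {q | q i ≤ demand F p}
  · obtain ⟨i, hi⟩ := h
    have hn : 1 ≤ n := Nat.one_le_iff_ne_zero.2 fun h => by subst h; exact i.elim0
    have h1 : p ≤ orderStat 1 (values F q) :=
      (le_orderStat_one_iff hn _ _).2 ⟨i, (le_valueAt_iff F (hq i)).2 hi.2⟩
    rw [Finset.sum_eq_single i, SPA_totalPay hn, if_pos h1, reservePayment, indicator_of_mem hi]
    · intro j _ hj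
      refine indicator_of_notMem (fun hj' => ?_) _
      exact lt_asymm (hi.1 j hj) (hj'.1 i hj.symm)
    · simp
  · push Not at h
    exact (Finset.sum_eq_zero fun i _ => indicator_of_notMem (h i) _).trans_le zero_le

/-- Fix the other quantiles and let `q j` be the lowest; it exists since `n ≥ 2`. Buyer `i` is
strongest exactly below `q j`, so her weighted allocation plus `ρ` is at most the ironed curve at `q
j`. On quantiles up to `min (q j) (demand F p)` she pays at least `max p (quantilePrice F (q j))`,
whose total dominates that value. -/
lemma le_lintegral_reservePayment (hn : 2 ≤ n) {F : ProbabilityMeasure ℝ} {p : ℝ} {ρ : ENNReal}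
    {ψ : ℝ → ENNReal} (hψ : Measurable ψ)
    (h : ∀ u ∈ Ioo (0 : ℝ) 1, ρ + ∫⁻ s in Ioc 0 u, ψ s ≤
      ENNReal.ofReal (min u (demand F p)) * ENNReal.ofReal (max p (quantilePrice F u)))
    (i : Fin n) :
    ρ + ∫⁻ q, ψ (q i) * (strongest i).indicator 1 q ∂quantileLaw n ≤
      ∫⁻ q, reservePayment F p i q ∂quantileLaw n := by
  have hψa : Measurable fun q : Fin n → ℝ => ψ (q i) * (strongest i).indicator 1 q :=
    (hψ.comp (measurable_pi_apply i)).mul (measurable_one.indicator (measurableSet_strongest i))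
  rw [lintegral_quantileLaw_update i (measurable_reservePayment F p i),
    lintegral_quantileLaw_update i hψa]
  calc _ = ∫⁻ q, (ρ + ∫⁻ u, ψ (Function.update q i u i) *
          (strongest i).indicator 1 (Function.update q i u) ∂uniform) ∂quantileLaw n := by
        rw [lintegral_add_left measurable_const, lintegral_const, measure_univ, mul_one]
    _ ≤ _ := ?_
  refine lintegral_mono_ae ?_
  filter_upwards [ae_quantileLaw_mem (n := n)] with q hq
  have hne : (Finset.univ.erase i).Nonempty := by
    rw [← Finset.card_pos, Finset.card_erase_of_mem (Finset.mem_univ i), Finset.card_univ,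
      Fintype.card_fin]
    omega
  obtain ⟨j, hj, hjmin⟩ := Finset.exists_min_image (Finset.univ.erase i) q hne
  have hji : j ≠ i := Finset.ne_of_mem_erase hj
  have hstrong : ∀ u, Function.update q i u ∈ strongest i ↔ u < q j := by
    intro u
    constructor
    · intro hu
      simpa [hji] using hu j hji
    · intro hu l hl
      have := hjmin l (Finset.mem_erase.2 ⟨hl, Finset.mem_univ l⟩)
      simpa [hl] using hu.trans_le this
  have hlhs : ∫⁻ u, ψ (Function.update q i u i) *
      (strongest i).indicator 1 (Function.update q i u) ∂uniform ≤ ∫⁻ s in Ioc 0 (q j), ψ s := by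
    rw [uniform, ← lintegral_indicator measurableSet_Ioc, ← lintegral_indicator measurableSet_Ioo]
    refine lintegral_mono fun u => ?_
    by_cases hu : u ∈ Ioo (0 : ℝ) 1
    swap
    · rw [indicator_of_notMem hu]; exact zero_le
    rw [indicator_of_mem hu, Function.update_self]
    by_cases huj : u < q j
    · rw [indicator_of_mem (show u ∈ Ioc 0 (q j) from ⟨hu.1, huj.le⟩),
        indicator_of_mem ((hstrong u).2 huj), Pi.one_apply, mul_one]
    · rw [indicator_of_notMem (fun h' => huj ((hstrong u).1 h')), mul_zero]
      exact zero_le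
  refine (add_le_add le_rfl hlhs).trans ((h _ (hq j)).trans ?_)
  set C := ENNReal.ofReal (max p (quantilePrice F (q j))) with hC
  calc ENNReal.ofReal (min (q j) (demand F p)) * C
      = ∫⁻ u, (Iic (min (q j) (demand F p))).indicator (fun _ => C) u ∂uniform := by
        rw [lintegral_indicator_const measurableSet_Iic,
          uniform_Iic ((min_le_left _ _).trans (hq j).2.le), mul_comm]
    _ ≤ _ := by
        refine lintegral_mono_ae ?_
        have hnej : ∀ᵐ u ∂uniform, u ≠ q j := by
          rw [uniform]
          exact ae_restrict_of_ae (by simp [ae_iff])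
        filter_upwards [ae_uniform_mem, hnej] with u hu huj
        by_cases hmem : u ∈ Iic (min (q j) (demand F p))
        swap
        · rw [indicator_of_notMem hmem]; exact zero_le
        obtain ⟨h1, h2⟩ := le_min_iff.1 (show u ≤ min (q j) (demand F p) from hmem)
        rw [indicator_of_mem hmem, reservePayment, indicator_of_mem]
        · refine ENNReal.ofReal_le_ofReal (max_le_max le_rfl ?_)
          rw [← valueAt_of_mem F (hq j)]
          refine le_orderStat_two_of hn hji ?_ ?_
          · simp [values, hji]
          · simpa [values] using valueAt_antitoneOn F hu (hq j) h1
        · exact ⟨(hstrong u).2 (lt_of_le_of_ne h1 huj), by simpa using h2⟩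

/-- The lowest quantile has the largest weight. Weights are never negative, so withholding the item
brings no gain. -/
lemma sum_virtual_surplus_le (hn : 1 ≤ n) {ψ : ℝ → ENNReal} (hψ : AntitoneOn ψ (Ioi 0))
    {q : Fin n → ℝ} (hq : ∀ i, q i ∈ Ioo (0 : ℝ) 1) (hinj : ∀ i j, i ≠ j → q i ≠ q j)
    {x : Fin n → ℝ} (hx : ∀ i, 0 ≤ x i) (hsum : ∑ i, x i ≤ 1) :
    ∑ i, ψ (q i) * ENNReal.ofReal (x i) ≤ ∑ i, ψ (q i) * (strongest i).indicator 1 q := by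
  obtain ⟨m, -, hm⟩ := Finset.exists_min_image Finset.univ q ⟨⟨0, hn⟩, Finset.mem_univ _⟩
  have hms : q ∈ strongest m := fun j hj =>
    lt_of_le_of_ne (hm j (Finset.mem_univ j)) (hinj m j hj.symm)
  calc ∑ i, ψ (q i) * ENNReal.ofReal (x i) ≤ ∑ i, ψ (q m) * ENNReal.ofReal (x i) :=
        Finset.sum_le_sum fun i _ =>
          mul_le_mul_left (hψ (hq m).1 (hq i).1 (hm i (Finset.mem_univ i))) _
    _ = ψ (q m) * ENNReal.ofReal (∑ i, x i) := by
        rw [← Finset.mul_sum, ENNReal.ofReal_sum_of_nonneg fun i _ => hx i]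
    _ ≤ ψ (q m) * 1 := mul_le_mul_right (by simpa using ENNReal.ofReal_le_ofReal hsum) _
    _ = ψ (q m) * (strongest m).indicator 1 q := by rw [indicator_of_mem hms, Pi.one_apply]
    _ ≤ _ := Finset.single_le_sum (f := fun i => ψ (q i) * (strongest i).indicator 1 q)
        (fun i _ => zero_le) (Finset.mem_univ m)

/-- For i.i.d. values whose revenue curve is concave above the monopoly reserve, the second-price
auction with the monopoly reserve is optimal. -/
lemma Rev_le_Rev_SPA (hn : 2 ≤ n) {F : ProbabilityMeasure ℝ} {p : ℝ} (hp : IsMonopolyReserve F p)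
    (hc : RevenueCurveConcaveAbove F p) {M : Mechanism n} (hd : M.IsDSIC) (hi : M.IsIR) :
    Rev M (iid n F) ≤ Rev (SPA n p) (iid n F) := by
  obtain ⟨ρ, ψ, hψ, hanti, h⟩ := exists_ironed_density hp hc
  rw [Rev_SPA (by omega) hp.1]
  -- Discarding negative payments only helps the competing mechanism, and no integrability has to be
  -- checked.
  have h1 : Rev M (iid n F) ≤
      ((∫⁻ v, ENNReal.ofReal (M.totalPay v) ∂profileLaw (iid n F) : ENNReal) : EReal) :=
    EReal.sub_le_of_le_add (le_add_of_nonneg_right (EReal.coe_ennreal_nonneg _))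
  refine h1.trans (EReal.coe_ennreal_le_coe_ennreal_iff.2 ?_)
  rw [profileLaw_iid_eq_map, lintegral_map (measurable_totalPay M).ennreal_ofReal
    (measurable_values F), lintegral_map (measurable_totalPay _).ennreal_ofReal
    (measurable_values F)]
  have hme : ∀ i, Measurable fun q : Fin n → ℝ => envelopePayment M i (values F q) := fun i =>
    (measurable_envelopePayment M i).comp (measurable_values F)
  have hms : ∀ i : Fin n, Measurable fun q : Fin n → ℝ => ψ (q i) * (strongest i).indicator 1 q :=
    fun i => (hψ.comp (measurable_pi_apply i)).mul
      (measurable_one.indicator (measurableSet_strongest i))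
  have hma : ∀ i : Fin n, Measurable fun q : Fin n → ℝ =>
      ψ (q i) * ENNReal.ofReal (M.alloc (values F q) i) := fun i =>
    (hψ.comp (measurable_pi_apply i)).mul
      ((M.measurable_alloc i).comp (measurable_values F)).ennreal_ofReal
  calc ∫⁻ q, ENNReal.ofReal (M.totalPay (values F q)) ∂quantileLaw n
      ≤ ∫⁻ q, ∑ i, envelopePayment M i (values F q) ∂quantileLaw n := by
        refine lintegral_mono fun q => ?_
        refine le_trans ?_ (Finset.sum_le_sum fun i _ => ofReal_pay_le hd hi (values F q) i)
        exact Finset.le_sum_of_subadditive ENNReal.ofReal ENNReal.ofReal_zero.le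
          (fun _ _ => ENNReal.ofReal_add_le) _ _
    _ = ∑ i, ∫⁻ q, envelopePayment M i (values F q) ∂quantileLaw n :=
        lintegral_finsetSum _ fun i _ => hme i
    _ ≤ ∑ i : Fin n, (ρ + ∫⁻ q, ψ (q i) * ENNReal.ofReal (M.alloc (values F q) i) ∂quantileLaw n) :=
        Finset.sum_le_sum fun i _ => lintegral_envelopePayment_le hd F hψ (fun u hu => (h u hu).1) i
    _ = ∑ _i : Fin n, ρ +
          ∫⁻ q, ∑ i, ψ (q i) * ENNReal.ofReal (M.alloc (values F q) i) ∂quantileLaw n := by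
        rw [Finset.sum_add_distrib, lintegral_finsetSum _ fun i _ => hma i]
    _ ≤ ∑ _i : Fin n, ρ + ∫⁻ q, ∑ i, ψ (q i) * (strongest i).indicator 1 q ∂quantileLaw n := by
        refine add_le_add le_rfl (lintegral_mono_ae ?_)
        filter_upwards [ae_quantileLaw_mem (n := n), ae_quantileLaw_injective (n := n)]
          with q hq hinj
        exact sum_virtual_surplus_le (by omega) hanti hq hinj (fun i => M.alloc_nonneg _ i)
          (M.sum_alloc_le_one _)
    _ = ∑ i : Fin n, (ρ + ∫⁻ q, ψ (q i) * (strongest i).indicator 1 q ∂quantileLaw n) := by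
        rw [Finset.sum_add_distrib, lintegral_finsetSum _ fun i _ => hms i]
    _ ≤ ∑ i, ∫⁻ q, reservePayment F p i q ∂quantileLaw n :=
        Finset.sum_le_sum fun i _ => le_lintegral_reservePayment hn hψ (fun u hu => (h u hu).2) i
    _ = ∫⁻ q, ∑ i, reservePayment F p i q ∂quantileLaw n :=
        (lintegral_finsetSum _ fun i _ => measurable_reservePayment F p i).symm
    _ ≤ _ := by
        refine lintegral_mono_ae ?_
        filter_upwards [ae_quantileLaw_mem (n := n)] with q hq
        exact sum_reservePayment_le F p hq

end Myerson

/-! ### From a non-decreasing virtual value to a concave revenue curve. -/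

section VirtualValue

open Set Filter Topology

lemma real_Ioi_le_of_forall_gt (F : ProbabilityMeasure ℝ) {q x : ℝ}
    (h : ∀ y, x < y → demand F y ≤ q) : (F : Measure ℝ).real (Ioi x) ≤ q := by
  have hmono : Monotone fun m : ℕ => Ici (x + 1 / ((m : ℝ) + 1)) := fun a b hab => by
    refine Ici_subset_Ici.2 ?_
    have := one_div_le_one_div_of_le (by positivity : (0 : ℝ) < a + 1)
      (by exact_mod_cast Nat.succ_le_succ hab : (a : ℝ) + 1 ≤ b + 1)
    linarith
  have := tendsto_measure_iUnion_atTop (μ := (F : Measure ℝ)) hmono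
  have he : ⋃ m : ℕ, Ici (x + 1 / ((m : ℝ) + 1)) = Ioi x := by
    ext y
    simp only [mem_iUnion, mem_Ici, mem_Ioi]
    refine ⟨fun ⟨m, hm⟩ => ?_, fun h => ?_⟩
    · have : (0 : ℝ) < 1 / ((m : ℝ) + 1) := by positivity
      linarith
    · obtain ⟨m, hm⟩ := exists_nat_one_div_lt (sub_pos.2 h)
      exact ⟨m, by linarith⟩
  rw [he] at this
  have ht := (ENNReal.tendsto_toReal (measure_ne_top (F : Measure ℝ) _)).comp this
  refine le_of_tendsto' ht fun m => h _ ?_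
  have : (0 : ℝ) < 1 / ((m : ℝ) + 1) := by positivity
  linarith

variable {F : ProbabilityMeasure ℝ} {f : ℝ → ℝ}

lemma real_Ioi_eq_demand
    (hF : (F : Measure ℝ) = volume.withDensity fun v => ENNReal.ofReal (f v)) (x : ℝ) :
    (F : Measure ℝ).real (Ioi x) = demand F x := by
  have h0 : (F : Measure ℝ) {x} = 0 := by
    rw [hF]; exact withDensity_absolutelyContinuous _ _ (by simp)
  refine congrArg ENNReal.toReal (le_antisymm (measure_mono Ioi_subset_Ici_self) ?_)
  rw [← Ioi_union_left]
  exact (measure_union_le _ _).trans (by rw [h0, add_zero])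

/-- Without atoms the demand is continuous, so the quantile is met exactly. -/
lemma demand_quantilePrice_of_density
    (hF : (F : Measure ℝ) = volume.withDensity fun v => ENNReal.ofReal (f v)) {q p : ℝ}
    (hq : 0 < q) (hp : q ≤ demand F p) : demand F (quantilePrice F q) = q := by
  refine le_antisymm ?_ (demand_quantilePrice_ge F hq hp).1
  rw [← real_Ioi_eq_demand hF]
  refine real_Ioi_le_of_forall_gt F fun y hy => ?_
  by_contra! hlt
  exact absurd ((le_quantilePrice_iff' F hq ⟨p, hp⟩).2 hlt.le) (not_le.2 hy)

lemma integrable_density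
    (hfm : Measurable f) (hf0 : ∀ v, 0 ≤ f v)
    (hF : (F : Measure ℝ) = volume.withDensity fun v => ENNReal.ofReal (f v)) :
     Integrable f := by
  refine ⟨hfm.aestronglyMeasurable, ?_⟩
  rw [hasFiniteIntegral_iff_ofReal (Eventually.of_forall hf0)]
  have : ∫⁻ v, ENNReal.ofReal (f v) = (F : Measure ℝ) univ := by
    rw [hF, withDensity_apply _ MeasurableSet.univ, Measure.restrict_univ]
  rw [this]
  exact measure_lt_top _ _

lemma demand_sub_demand
    (hfm : Measurable f) (hf0 : ∀ v, 0 ≤ f v)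
    (hF : (F : Measure ℝ) = volume.withDensity fun v => ENNReal.ofReal (f v))
    {x y : ℝ} (hxy : x ≤ y) :
    demand F x - demand F y = ∫ z in x..y, f z := by
  have h1 : (F : Measure ℝ).real (Ioc x y) = ∫ z in x..y, f z := by
    rw [intervalIntegral.integral_of_le hxy, integral_eq_lintegral_of_nonneg_ae
      (Eventually.of_forall hf0) hfm.aestronglyMeasurable, measureReal_def, hF,
      withDensity_apply _ measurableSet_Ioc]
  rw [← h1, ← real_Ioi_eq_demand hF, ← real_Ioi_eq_demand hF, ← Ioc_union_Ioi_eq_Ioi hxy,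
    measureReal_union (by
      rw [Set.disjoint_left]; exact fun z hz hz' => absurd hz.2 (not_le.2 hz')) measurableSet_Ioi]
  ring

lemma intervalIntegrable_surplus
    (hfm : Measurable f) (hf0 : ∀ v, 0 ≤ f v)
    (hF : (F : Measure ℝ) = volume.withDensity fun v => ENNReal.ofReal (f v))
    (c x y : ℝ) :
    IntervalIntegrable (fun z => (z - c) * f z) volume x y :=
  (integrable_density hfm hf0 hF).intervalIntegrable.continuousOn_mul (by fun_prop)

/-- Formally the derivative of `(z - c) * demand F z` is `demand F z - (z - c) * f z`, which is
nonnegative by assumption. As `f` is only measurable, increments over short intervals take the place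
of derivatives. -/
lemma surplus_le_of_le
    (hfm : Measurable f) (hf0 : ∀ v, 0 ≤ f v)
    (hF : (F : Measure ℝ) = volume.withDensity fun v => ENNReal.ofReal (f v))
    {c x y : ℝ} (hxy : x ≤ y)
    (h : ∀ z ∈ Icc x y, (z - c) * f z ≤ demand F z) :
    (x - c) * demand F x ≤ (y - c) * demand F y := by
  refine le_of_forall_increment (H := fun z => (z - c) * demand F z) (e := fun z => -demand F z) hxy
    fun z w hxz hzw hwy => ?_
  have hi := (integrable_density hfm hf0 hF).intervalIntegrable (a := z) (b := w)
  have hs := intervalIntegrable_surplus hfm hf0 hF c z w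
  have e1 : ∫ s in z..w, (z - c) * f s ≤ ∫ s in z..w, (s - c) * f s :=
    intervalIntegral.integral_mono_on hzw (hi.const_mul _) hs fun s hs =>
      mul_le_mul_of_nonneg_right (by linarith [hs.1]) (hf0 s)
  have e2 : ∫ s in z..w, (s - c) * f s ≤ ∫ s in z..w, demand F z :=
    intervalIntegral.integral_mono_on hzw hs (by simp) fun s hs =>
      (h s ⟨hxz.trans hs.1, hs.2.trans hwy⟩).trans (demand_antitone F hs.1)
  rw [intervalIntegral.integral_const_mul, ← demand_sub_demand hfm hf0 hF hzw] at e1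
  rw [intervalIntegral.integral_const, smul_eq_mul] at e2
  nlinarith

lemma surplus_le_of_ge
    (hfm : Measurable f) (hf0 : ∀ v, 0 ≤ f v)
    (hF : (F : Measure ℝ) = volume.withDensity fun v => ENNReal.ofReal (f v))
    {c x y : ℝ} (hxy : x ≤ y)
    (h : ∀ z ∈ Icc x y, demand F z ≤ (z - c) * f z) :
    (y - c) * demand F y ≤ (x - c) * demand F x := by
  refine neg_le_neg_iff.1 (le_of_forall_increment (H := fun z => -((z - c) * demand F z))
    (e := fun z => -demand F z) hxy fun z w hxz hzw hwy => ?_)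
  have hi := (integrable_density hfm hf0 hF).intervalIntegrable (a := z) (b := w)
  have hs := intervalIntegrable_surplus hfm hf0 hF c z w
  have e1 : ∫ s in z..w, (s - c) * f s ≤ ∫ s in z..w, (w - c) * f s :=
    intervalIntegral.integral_mono_on hzw hs (hi.const_mul _) fun s hs =>
      mul_le_mul_of_nonneg_right (by linarith [hs.2]) (hf0 s)
  have e2 : ∫ s in z..w, demand F w ≤ ∫ s in z..w, (s - c) * f s :=
    intervalIntegral.integral_mono_on hzw (by simp) hs fun s hs =>
      (demand_antitone F hs.2).trans (h s ⟨hxz.trans hs.1, hs.2.trans hwy⟩)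
  rw [intervalIntegral.integral_const_mul, ← demand_sub_demand hfm hf0 hF hzw] at e1
  rw [intervalIntegral.integral_const, smul_eq_mul] at e2
  nlinarith

/-- A non-decreasing virtual value above `p` makes the revenue curve concave there. -/
lemma VirtualValueMonotoneAbove.revenueCurveConcaveAbove {p : ℝ}
    (h : VirtualValueMonotoneAbove F p) : RevenueCurveConcaveAbove F p := by
  obtain ⟨f, hfm, hf0, hF, hpos, hmono⟩ := h
  have hIoi := real_Ioi_eq_demand hF
  have hdem : ∀ z, p ≤ z → 0 < demand F z → demand F z = (z - virtualValue F f z) * f z := by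
    intro z hz hz'
    have := hpos z hz (by rwa [hIoi])
    rw [virtualValue, hIoi]
    field_simp
    ring
  have hvv : ∀ z w, p ≤ z → z ≤ w → 0 < demand F w → virtualValue F f z ≤ virtualValue F f w :=
    fun z w hz hzw hw => hmono ⟨hz, by rw [hIoi]; exact hw.trans_le (demand_antitone F hzw)⟩
      ⟨hz.trans hzw, by rwa [hIoi]⟩ hzw
  refine concaveOn_of_slope_anti_adjacent (convex_Icc _ _) fun {x y z} hx hz hxy hyz => ?_
  have hy0 : 0 < y := hx.1.trans_lt hxy
  have hz0 : 0 < z := hy0.trans hyz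
  have hyp : y ≤ demand F p := hyz.le.trans hz.2
  have dy := demand_quantilePrice_of_density hF hy0 hyp
  have dz := demand_quantilePrice_of_density hF hz0 hz.2
  have py := (demand_quantilePrice_ge F hy0 hyp).2
  have pz := (demand_quantilePrice_ge F hz0 hz.2).2
  set b := quantilePrice F y with hb
  have hab : quantilePrice F z ≤ b :=
    (le_quantilePrice_iff' F hy0 ⟨p, hyp⟩).2 (by rw [dz]; exact hyz.le)
  -- The line of slope `c` supports the revenue curve at `y`: the surplus `(s - c) * demand F s` has
  -- formal derivative `(c - virtualValue F f s) * f s`, which changes sign from plus to minus at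
  -- `b`. The bounds `up` and `lo` use the two sides.
  set c := virtualValue F f b with hc
  have up : revenueCurve F z - revenueCurve F y ≤ c * (z - y) := by
    have := surplus_le_of_le (c := c) hfm hf0 hF hab fun s hs => by
      have hs0 : 0 < demand F s := by
        refine lt_of_lt_of_le ?_ (demand_antitone F hs.2); rw [dy]; exact hy0
      rw [hdem s (pz.trans hs.1) hs0]
      refine mul_le_mul_of_nonneg_right ?_ (hf0 s)
      linarith [hvv s b (pz.trans hs.1) hs.2 (by rw [dy]; exact hy0)]
    rw [dy, dz] at this
    simp only [revenueCurve_eq]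
    rw [← hb]
    linarith
  have lo : c * (y - x) ≤ revenueCurve F y - revenueCurve F x := by
    -- At the quantile `0` there is no price to compare with; there the bound reduces to the virtual
    -- value being at most the value.
    rcases hx.1.eq_or_lt with rfl | hx0
    · have hcb : c ≤ b := by
        have hb0 : 0 < demand F b := by rw [dy]; exact hy0
        have h1 := hdem b py hb0
        have h2 := hpos b py (by rwa [hIoi])
        rw [h1] at hb0
        linarith [pos_of_mul_pos_left hb0 h2.le]
      simp only [revenueCurve_eq]
      rw [← hb]
      nlinarith
    · have hxp : x ≤ demand F p := hxy.le.trans hyp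
      have dx := demand_quantilePrice_of_density hF hx0 hxp
      have hbc : b ≤ quantilePrice F x :=
        (le_quantilePrice_iff' F hx0 ⟨p, hxp⟩).2 (by rw [dy]; exact hxy.le)
      have := surplus_le_of_ge (c := c) hfm hf0 hF hbc fun s hs => by
        have hs0 : 0 < demand F s := by
          refine lt_of_lt_of_le ?_ (demand_antitone F hs.2); rw [dx]; exact hx0
        conv_lhs => rw [hdem s (py.trans hs.1) hs0]
        refine mul_le_mul_of_nonneg_right ?_ (hf0 s)
        linarith [hvv b s py hs.1 hs0]
      rw [dy, dx] at this
      simp only [revenueCurve_eq]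
      rw [← hb]
      linarith
  rw [div_le_iff₀ (sub_pos.2 hyz)]
  refine up.trans (mul_le_mul_of_nonneg_right ?_ (sub_pos.2 hyz).le)
  rwa [le_div_iff₀ (sub_pos.2 hxy)]

end VirtualValue

end OrderStatAuction

theorem theorem3 (n k : ℕ) (hk : 2 ≤ k) (hkn : k ≤ n) (G : ProbabilityMeasure ℝ) :
    (∃! F : ProbabilityMeasure ℝ, iid n F ∈ ambiguitySet n k G) ∧
    ∀ F : ProbabilityMeasure ℝ, iid n F ∈ ambiguitySet n k G →
      (∀ p : ℝ, (0 ≤ p ∨ (G : Measure ℝ) (Set.Iio 0) = 0) →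
        IsLeast (Rev (SPA n p) '' ambiguitySet n k G) (Rev (SPA n p) (iid n F))) ∧
      (∀ p : ℝ, IsMonopolyReserve F p → RegularAboveReserve F p →
        ((SPA n p).IsDSIC ∧ (SPA n p).IsIR) ∧
        IsLeast (Rev (SPA n p) '' ambiguitySet n k G) (Rev (SPA n p) (iid n F)) ∧
        Rev (SPA n p) (iid n F) = robustRevenue n k G) := by
  refine ⟨?_, fun F hF => ⟨fun p hp => isLeast_Rev_SPA hk hkn hF hp, fun p hp hreg => ?_⟩⟩
  · obtain ⟨l, rfl⟩ := Nat.exists_eq_add_of_le' (one_le_two.trans hk)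
    obtain ⟨F, hF⟩ := exists_iid_mem_ambiguitySet hkn G
    exact ⟨F, hF, fun F' hF' => iid_mem_ambiguitySet_unique hkn hF' hF⟩
  have hn : 2 ≤ n := hk.trans hkn
  have hleast := isLeast_Rev_SPA hk hkn hF (Or.inl hp.1)
  have hmech : (SPA n p).IsDSIC ∧ (SPA n p).IsIR := ⟨SPA_isDSIC hn p, SPA_isIR hn p⟩
  have hc : RevenueCurveConcaveAbove F p := hreg.elim (·.revenueCurveConcaveAbove) id
  refine ⟨hmech, hleast, le_antisymm ?_ ?_⟩
  · exact le_iSup₂_of_le (SPA n p) hmech (le_iInf₂ fun H hH => hleast.2 ⟨H, hH, rfl⟩)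
  · exact iSup₂_le fun M hM => (iInf₂_le _ hF).trans (Rev_le_Rev_SPA hn hp hc hM.1 hM.2)
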